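/- Let $b=(b_k)_{k\ge1}\in\ell^2(\mathbb R)$ with $b_k\neq0$ for all $k$ (A1), and let $(\omega_k)_{k\ge1}$ be real numbers with $\omega_1>0$ and $\omega_{k+1}-\omega_k\ge\omega_*>0$ for all $k$ (A2) and $\sup_k\sum_{j\ne k}(\omega_k-\omega_j)^{-2}<\infty$ (A3). Put $H=\ell^2(\mathbb R)\times\ell^2(\mathbb R)$, $X=(\ell^2(\mathbb C))^4$, $\Omega=\mathrm{diag}(\omega_1,\omega_2,\dots)$, $A=\begin{pmatrix}0&\Omega\\-\Omega&0\end{pmatrix}$, $B=\begin{pmatrix}0\\b\end{pmatrix}$, and let $V_{0,1}$ be the space of all $x=(\xi,\eta)\in H$ with $\|x\|_{V_{0,1}}^2=\sum_k(\xi_k^2+\eta_k^2)/|b_k|^2<\infty$. For $\bar x\in H$ and $\bar u\in\mathbb R$, let $(\hat x,\hat u)\in H\times\mathbb R$ be the minimizer of $\|x-\bar x\|_H^2+|u-\bar u|^2$ subject to $Ax+Bu=0$, and let $\hat\Lambda=(\hat\lambda,\hat\mu)\in H$ be its Lagrange multiplier, i.e. $\hat x-\bar x=A^*\hat\Lambda$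 and $\hat u-\bar u=B^*\hat\Lambda$. For $T>0$ and $x^0\in V_{0,1}$, let $(x,u)$ minimize $\int_0^T(\|x(t)-\bar x\|_H^2+|u(t)-\bar u|^2)\,dt$ over all $u\in L^2(0,T)$ and $x\in C([0,T];H)$ with $\dot x=Ax+Bu$ and $x(0)=x^0$, and let $\Lambda=(\lambda,\mu)\in C([0,T];H)$ be the associated adjoint state, i.e. the solution of $\dot\Lambda=A\Lambda+x-\bar x$, $\Lambda(T)=0$. Let $\Delta(t)=(x(t)-\hat x,\ \Lambda(t)-\hat\Lambda)\in X$ be the discrepancy. Then there is a constant $\bar C>0$, depending only on $(\omega_k)$ and $(b_k)$ (in particular not on $T$, $x^0$, $\bar x$, $\bar u$), such that in every such situation $$\|\Delta(0)\|_X+\|\Delta(T)\|_X\le\bar C\left(\|x(0)-\hat x\|_{V_{0,1}}+\|\hat\lambda\|_{\ell^2}+\|\hat\mu\|_{\ell^2}\right).$$ -/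

import Mathlib

open MeasureTheory

noncomputable section

namespace OscTurnpike

/-- The Hilbert space `ℓ²(𝕜)` of square-summable sequences. The modes `1, 2, 3, …` are indexed by
`ℕ = {0, 1, 2, …}`, so that index `k` stands for the mode `k + 1`. -/
abbrev Ell2 (𝕜 : Type) [RCLike 𝕜] : Type := lp (fun _ : ℕ => 𝕜) 2

/-- The real state space `H = ℓ²(ℝ) × ℓ²(ℝ)` of pairs `(ξ, η)`, with its Hilbert norm. -/
abbrev H : Type := WithLp 2 (Ell2 ℝ × Ell2 ℝ)

/-- The complex Hilbert space `X = (ℓ²(ℂ))⁴`. -/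
abbrev X : Type := PiLp 2 (fun _ : Fin 4 => Ell2 ℂ)

/-- The condition `b_k ≠ 0` for all `k`; that `b` lies in `ℓ²(ℝ)` is part of its type. -/
def CondA1 (b : Ell2 ℝ) : Prop := ∀ k, b k ≠ 0

/-- `ω₁ > 0` and `ω_{k+1} - ω_k ≥ ω_* > 0` for all `k`. -/
def CondA2 (ω : ℕ → ℝ) : Prop := 0 < ω 0 ∧ ∃ ωs : ℝ, 0 < ωs ∧ ∀ k, ωs ≤ ω (k + 1) - ω k

/-- `∑_{j ≠ k} 1 / (ω_k - ω_j)²` is finite and bounded uniformly in `k`. -/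
def CondA3 (ω : ℕ → ℝ) : Prop :=
  ∃ C : ℝ, ∀ k, Summable (fun j : {j : ℕ // j ≠ k} => 1 / (ω k - ω j) ^ 2) ∧
    ∑' j : {j : ℕ // j ≠ k}, 1 / (ω k - ω j) ^ 2 ≤ C

/-- The `k`-th term `ω_k^{2p} (ξ_k² + η_k²) / |b_k|^{2q}` of the squared norm of `V_{p,q}`. -/
def vTerm (ω : ℕ → ℝ) (b : Ell2 ℝ) (p q : ℝ) (x : H) (k : ℕ) : ℝ :=
  ω k ^ (2 * p) * ((x.fst k) ^ 2 + (x.snd k) ^ 2) / |b k| ^ (2 * q)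

/-- Membership of an element of `H` in the space `V_{p,q}`. -/
def MemV (ω : ℕ → ℝ) (b : Ell2 ℝ) (p q : ℝ) (x : H) : Prop := Summable (vTerm ω b p q x)

/-- The norm of `V_{p,q}`. -/
def normV (ω : ℕ → ℝ) (b : Ell2 ℝ) (p q : ℝ) (x : H) : ℝ := Real.sqrt (∑' k, vTerm ω b p q x k)

/-- The control vector `B = (0, b)`. -/
def vecB (b : Ell2 ℝ) : H := WithLp.toLp 2 (0, b)

/-- `y ∈ C([0,T]; H)` solves `y'(t) = A y(t) + f(t)` on `[0,T]`, where `A = [[0, Ω], [-Ω, 0]]`,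
`Ω = diag(ω₁, ω₂, …)`: mode by mode and integrated in time, i.e. as an identity in the larger
space `V_{-1,0}`, in which `A y(t)` lies. -/
structure IsSolution (ω : ℕ → ℝ) (T : ℝ) (f : ℝ → H) (y : ℝ → H) : Prop where
  cont : ContinuousOn y (Set.Icc 0 T)
  fst_eq : ∀ k, ∀ t ∈ Set.Icc (0 : ℝ) T,
    (y t).fst k = (y 0).fst k + ∫ s in (0 : ℝ)..t, (ω k * (y s).snd k + (f s).fst k)
  snd_eq : ∀ k, ∀ t ∈ Set.Icc (0 : ℝ) T,
    (y t).snd k = (y 0).snd k + ∫ s in (0 : ℝ)..t, (-(ω k * (y s).fst k) + (f s).snd k)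

/-- Admissible pairs of the dynamic problem: `u ∈ L²(0,T)`, `x' = A x + B u`, `x(0) = x⁰`. -/
structure IsAdmissible (ω : ℕ → ℝ) (b : Ell2 ℝ) (T : ℝ) (x0 : H) (x : ℝ → H) (u : ℝ → ℝ) :
    Prop where
  memLp : MemLp u 2 (volume.restrict (Set.Ioc 0 T))
  sol : IsSolution ω T (fun t => u t • vecB b) x
  init : x 0 = x0

/-- The cost `J_d(x, u) = ∫₀ᵀ (‖x(t) - x̄‖²_H + |u(t) - ū|²) dt`. -/
def dynCost (T : ℝ) (xbar : H) (ubar : ℝ) (x : ℝ → H) (u : ℝ → ℝ) : ℝ :=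
  ∫ t in (0 : ℝ)..T, (‖x t - xbar‖ ^ 2 + |u t - ubar| ^ 2)

/-- `(x, Λ, u)` is a solution of the dynamic problem: `(x, u)` minimizes the cost among the
admissible pairs, and `Λ` is the associated adjoint state, i.e. the solution of
`Λ' = A Λ + x - x̄`, `Λ(T) = 0`. -/
structure IsDynamicSolution (ω : ℕ → ℝ) (b : Ell2 ℝ) (T : ℝ) (x0 xbar : H) (ubar : ℝ)
    (x Λ : ℝ → H) (u : ℝ → ℝ) : Prop where
  admissible : IsAdmissible ω b T x0 x u
  minimal : ∀ (x' : ℝ → H) (u' : ℝ → ℝ), IsAdmissible ω b T x0 x' u' →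
    dynCost T xbar ubar x u ≤ dynCost T xbar ubar x' u'
  adjoint : IsSolution ω T (fun t => x t - xbar) Λ
  terminal : Λ T = 0

/-- The constraint `A x + B u = 0` of the static problem, an identity in `V_{-1,0}`. -/
def StaticConstraint (ω : ℕ → ℝ) (b : Ell2 ℝ) (x : H) (u : ℝ) : Prop :=
  ∀ k, ω k * x.snd k = 0 ∧ -(ω k * x.fst k) + b k * u = 0

/-- The cost `J_s(x, u) = ‖x - x̄‖²_H + |u - ū|²`. -/
def staticCost (xbar : H) (ubar : ℝ) (x : H) (u : ℝ) : ℝ := ‖x - xbar‖ ^ 2 + |u - ubar| ^ 2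

/-- `(x̂, û)` minimizes the static cost under the static constraint, and `Λ̂ = (λ̂, μ̂) ∈ H` is the
associated Lagrange multiplier: the derivative of
`½ J_s(x, u) - ∑ (λ̂_k ω_k η_k + μ̂_k (-ω_k ξ_k + b_k u))` with respect to each `ξ_k`, each `η_k`
and `u` vanishes at `(x̂, û)`, i.e. `x̂ - x̄ = A* Λ̂` and `û - ū = B* Λ̂`. -/
structure IsStaticSolution (ω : ℕ → ℝ) (b : Ell2 ℝ) (xbar : H) (ubar : ℝ)
    (xhat Lhat : H) (uhat : ℝ) : Prop where
  feasible : StaticConstraint ω b xhat uhat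
  minimal : ∀ (x : H) (u : ℝ), StaticConstraint ω b x u →
    staticCost xbar ubar xhat uhat ≤ staticCost xbar ubar x u
  stat_fst : ∀ k, xhat.fst k - xbar.fst k = -(ω k * Lhat.snd k)
  stat_snd : ∀ k, xhat.snd k - xbar.snd k = ω k * Lhat.fst k
  stat_control : uhat - ubar = inner ℝ (vecB b) Lhat

/-- A real square-summable sequence, seen as a complex one. -/
def toComplex (a : Ell2 ℝ) : Ell2 ℂ :=
  ⟨fun k => (a k : ℂ), (memℓp_gen_iff (by norm_num)).2 (by
    simpa using (memℓp_gen_iff (p := 2) (by norm_num)).1 (lp.memℓp a))⟩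

/-- The discrepancy `Δ(t) = (ξ(t) - ξ̂, η(t) - η̂, λ(t) - λ̂, μ(t) - μ̂) ∈ X`. -/
def discrepancy (x Λ : ℝ → H) (xhat Lhat : H) (t : ℝ) : X :=
  WithLp.toLp 2 ![toComplex (x t - xhat).fst, toComplex (x t - xhat).snd,
    toComplex (Λ t - Lhat).fst, toComplex (Λ t - Lhat).snd]

end OscTurnpike

end

/-!
In the eigenbasis of `A` the discrepancy solves `p' = iνp + ⟪β, q⟫ β`, `q' = iνq + p`, with `p`
standing for `x - x̂` and `q` for `Λ - Λ̂`. The data are `q(T)` and `r = p(0)/β`, whose norm is the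
`V_{0,1}` norm of the initial discrepancy; the unknowns are `p(T)` and `q(0)`.

The energy `∫ (‖p‖² + |⟪β, q⟫|²)` equals `Re ⟪p(T), q(T)⟫ - Re ⟪r, β̄ q(0)⟫`. It controls `p(T)`
directly and `β̄ q(0)` by observability (Ingham's inequality on a block of fixed length), so it is
linear in quantities that it dominates, and all of them are bounded by the data.

To remove the weight from `β̄ q(0)`, suppose first that the modes were decoupled, i.e. that the
coupling `⟪β, q⟫` in the `n`-th equation were `conj β_n q_n`: then `|q_n|² - |p_n/β_n|²` would be
conserved, and `q_n(0)` would be controlled by `r_n` and `q_n(T)`. The separation of the frequencies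
makes the off-diagonal coupling non-resonant: subtracting from `p_n/β_n` a corrector built from the
reduced resolvent of `diag(ν)` at `ν_n` removes it. The correctors are square-summable over the
modes, by a Hilbert-type inequality for square-separated frequencies, with a sum controlled by
`p` and `β̄ q`, hence integrally in time by the energy.
-/

namespace OscTurnpike

open Filter Topology
open scoped ComplexConjugate lp InnerProductSpace

section ExponentialSums

variable {ι : Type*} {ν : ι → ℝ} {K : ℝ}

/-- The frequencies `ν` are distinct and `∑_{m ≠ n} (ν_m - ν_n)⁻² ≤ K` for all `n`, the form of
(A3) for families of any index type. The diagonal term needs no exclusion, since `1 / 0 = 0`. -/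
structure SquareSeparated (ν : ι → ℝ) (K : ℝ) : Prop where
  injective : Function.Injective ν
  nonneg : 0 ≤ K
  sum_le : ∀ n (s : Finset ι), ∑ m ∈ s, 1 / (ν m - ν n) ^ 2 ≤ K

theorem hasDerivAt_exp_mul_I (x t : ℝ) :
    HasDerivAt (fun t : ℝ => Complex.exp (x * t * Complex.I))
      (Complex.exp (x * t * Complex.I) * (x * Complex.I)) t := by
  simpa using
    (((Complex.ofRealCLM.hasDerivAt (x := t)).const_mul (x : ℂ)).mul_const Complex.I).cexp

@[simp]
theorem norm_exp_mul_I (x t : ℝ) : ‖Complex.exp (x * t * Complex.I)‖ = 1 := by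
  exact_mod_cast Complex.norm_exp_ofReal_mul_I (x * t)

theorem mul_conj_self_eq (z : ℂ) : z * conj z = ((‖z‖ ^ 2 : ℝ) : ℂ) := by
  rw [Complex.mul_conj, Complex.normSq_eq_norm_sq]

theorem integral_ofReal_mul_exp {w w' : ℝ → ℝ} {x : ℝ} (hw : ∀ t, HasDerivAt w (w' t) t)
    (hw' : Continuous w') (hx : x ≠ 0) (a b : ℝ) :
    ∫ t in a..b, (w t : ℂ) * Complex.exp (x * t * Complex.I) =
      (w b * Complex.exp (x * b * Complex.I) - w a * Complex.exp (x * a * Complex.I)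
        - ∫ t in a..b, (w' t : ℂ) * Complex.exp (x * t * Complex.I)) / (x * Complex.I) := by
  have hxI : (x * Complex.I : ℂ) ≠ 0 := mul_ne_zero (by exact_mod_cast hx) Complex.I_ne_zero
  have h := intervalIntegral.integral_mul_deriv_eq_deriv_mul (a := a) (b := b)
    (u := fun t => (w t : ℂ)) (u' := fun t => (w' t : ℂ))
    (fun t _ => (hw t).ofReal_comp) (fun t _ => hasDerivAt_exp_mul_I x t)
    (Continuous.intervalIntegrable (by fun_prop) _ _)
    (Continuous.intervalIntegrable (by fun_prop) _ _)
  rw [eq_div_iff hxI, ← h, ← intervalIntegral.integral_mul_const]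
  simp only [mul_assoc]

/-- A weight on `[a, b]` that vanishes to second order at both ends. -/
def bump (a b t : ℝ) : ℝ := (t - a) ^ 2 * (b - t) ^ 2

@[fun_prop]
theorem continuous_bump (a b : ℝ) : Continuous (bump a b) := by unfold bump; fun_prop

theorem integral_bump (a b : ℝ) : ∫ t in a..b, bump a b t = (b - a) ^ 5 / 30 := by
  have hprim : ∀ t, HasDerivAt (fun t : ℝ => (b - a) ^ 2 * (t - a) ^ 3 / 3
      - (b - a) * (t - a) ^ 4 / 2 + (t - a) ^ 5 / 5) (bump a b t) t := by
    intro t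
    have h := (hasDerivAt_id t).sub_const a
    convert! ((((h.pow 3).const_mul ((b - a) ^ 2)).div_const 3).sub
      (((h.pow 4).const_mul (b - a)).div_const 2)).add ((h.pow 5).div_const 5) using 1
    unfold bump; push_cast; simp only [id]; ring
  rw [intervalIntegral.integral_eq_sub_of_hasDerivAt (fun t _ => hprim t)
    ((continuous_bump a b).intervalIntegrable _ _)]
  ring

theorem norm_integral_bump_exp_le {a b x : ℝ} (hab : a ≤ b) (hx : x ≠ 0) :
    ‖∫ t in a..b, (bump a b t : ℂ) * Complex.exp (x * t * Complex.I)‖ ≤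
      2 * (b - a) ^ 3 * (1 / x ^ 2) := by
  set w' : ℝ → ℝ := fun t => 2 * (t - a) * (b - t) ^ 2 - 2 * (t - a) ^ 2 * (b - t) with hw'
  set w'' : ℝ → ℝ := fun t => 2 * ((b - t) ^ 2 - 4 * (t - a) * (b - t) + (t - a) ^ 2) with hw''
  have hleft (t : ℝ) : HasDerivAt (fun t : ℝ => t - a) 1 t := (hasDerivAt_id t).sub_const a
  have hright (t : ℝ) : HasDerivAt (fun t : ℝ => b - t) (-1) t := (hasDerivAt_id t).const_sub b
  have hderiv (t : ℝ) : HasDerivAt (bump a b) (w' t) t := by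
    convert! ((hleft t).pow 2).mul ((hright t).pow 2) using 1
    simp only [hw', Pi.pow_apply]; push_cast; ring
  have hderiv' (t : ℝ) : HasDerivAt w' (w'' t) t := by
    convert! (((hleft t).const_mul 2).mul ((hright t).pow 2)).sub
      ((((hleft t).pow 2).const_mul 2).mul (hright t)) using 1
    simp only [hw'', Pi.pow_apply]; push_cast; ring
  have hbound : ∀ t ∈ Set.uIoc a b,
      ‖(w'' t : ℂ) * Complex.exp (x * t * Complex.I)‖ ≤ 2 * (b - a) ^ 2 := by
    intro t ht
    rw [Set.uIoc_of_le hab] at ht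
    rw [norm_mul, norm_exp_mul_I, mul_one, Complex.norm_real, Real.norm_eq_abs, abs_le]
    constructor
    · nlinarith [sq_nonneg (b + a - 2 * t), sq_nonneg (b - a)]
    · nlinarith [mul_nonneg (sub_nonneg.2 ht.1.le) (sub_nonneg.2 ht.2)]
  have hparts : ∫ t in a..b, (bump a b t : ℂ) * Complex.exp (x * t * Complex.I) =
      (∫ t in a..b, (w'' t : ℂ) * Complex.exp (x * t * Complex.I)) / (x * Complex.I) ^ 2 := by
    rw [integral_ofReal_mul_exp hderiv (by fun_prop) hx,
      integral_ofReal_mul_exp hderiv' (by fun_prop) hx]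
    simp only [bump, hw', sub_self]
    push_cast; ring
  rw [hparts, norm_div, norm_pow, norm_mul, Complex.norm_I, Complex.norm_real, Real.norm_eq_abs,
    mul_one, sq_abs, div_eq_mul_one_div]
  gcongr
  refine (intervalIntegral.norm_integral_le_of_norm_le_const hbound).trans (le_of_eq ?_)
  rw [abs_of_nonneg (sub_nonneg.2 hab)]; ring

theorem integral_ramp : ∫ t in (0 : ℝ)..1, (1 - t) = 1 / 2 := by
  rw [intervalIntegral.integral_sub (by simp) (by simp)]
  norm_num

theorem norm_integral_ramp_exp_sub_le {x : ℝ} (hx : x ≠ 0) :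
    ‖(∫ t in (0 : ℝ)..1, ((1 - t : ℝ) : ℂ) * Complex.exp (x * t * Complex.I))
      - Complex.I * ((1 / x : ℝ) : ℂ)‖ ≤ 2 * (1 / x ^ 2) := by
  have hxc : (x : ℂ) ≠ 0 := by exact_mod_cast hx
  have hexp : ∫ t in (0 : ℝ)..1, Complex.exp (x * t * Complex.I) =
      (Complex.exp (x * Complex.I) - 1) / (x * Complex.I) := by
    simpa using integral_ofReal_mul_exp (w := fun _ => 1) (w' := fun _ => 0)
      (fun t => hasDerivAt_const t 1) continuous_const hx 0 1
  have hramp : (∫ t in (0 : ℝ)..1, ((1 - t : ℝ) : ℂ) * Complex.exp (x * t * Complex.I))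
      - Complex.I * ((1 / x : ℝ) : ℂ) = (1 - Complex.exp (x * Complex.I)) / (x : ℂ) ^ 2 := by
    rw [integral_ofReal_mul_exp (w := fun t => 1 - t) (w' := fun _ => -1)
      (fun t => (hasDerivAt_id t).const_sub 1) continuous_const hx]
    simp only [sub_self, Complex.ofReal_neg, Complex.ofReal_one, Complex.ofReal_zero, neg_one_mul,
      intervalIntegral.integral_neg, hexp, mul_zero, zero_mul, Complex.exp_zero]
    push_cast
    field_simp
    ring_nf
    simp only [Complex.I_sq, Complex.I_pow_three]
    ring
  rw [hramp, norm_div, norm_pow, Complex.norm_real, Real.norm_eq_abs, sq_abs, div_eq_mul_one_div]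
  gcongr
  refine (norm_sub_le _ _).trans (le_of_eq ?_)
  rw [Complex.norm_exp_ofReal_mul_I]; norm_num

/-- The exponential sum with coefficients `c` and frequencies `ν` over a finite set of modes. -/
noncomputable def expSum (ν : ι → ℝ) (s : Finset ι) (c : ι → ℂ) (t : ℝ) : ℂ :=
  ∑ n ∈ s, c n * Complex.exp (ν n * t * Complex.I)

@[fun_prop]
theorem continuous_expSum (s : Finset ι) (c : ι → ℂ) : Continuous (expSum ν s c) := by
  unfold expSum; fun_prop

theorem integral_mul_expSum_mul_conj {w : ℝ → ℝ} (hw : Continuous w) (a b : ℝ) (s : Finset ι)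
    (c d : ι → ℂ) :
    ∫ t in a..b, (w t : ℂ) * (expSum ν s c t * conj (expSum ν s d t)) =
      ∑ m ∈ s, ∑ n ∈ s, c m * conj (d n) *
        ∫ t in a..b, (w t : ℂ) * Complex.exp ((ν m - ν n : ℝ) * t * Complex.I) := by
  have hexpand (t : ℝ) : (w t : ℂ) * (expSum ν s c t * conj (expSum ν s d t)) =
      ∑ m ∈ s, ∑ n ∈ s, c m * conj (d n) *
        ((w t : ℂ) * Complex.exp ((ν m - ν n : ℝ) * t * Complex.I)) := by
    rw [expSum, expSum, map_sum, Finset.sum_mul_sum]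
    simp only [Finset.mul_sum]
    refine Finset.sum_congr rfl fun m _ => Finset.sum_congr rfl fun n _ => ?_
    have hfreq : ((ν m - ν n : ℝ) : ℂ) * t * Complex.I
        = ν m * t * Complex.I + conj (ν n * t * Complex.I) := by
      simp only [map_mul, Complex.conj_ofReal, Complex.conj_I]; push_cast; ring
    rw [hfreq, Complex.exp_add, map_mul, ← Complex.exp_conj]
    ring
  simp_rw [hexpand]
  rw [intervalIntegral.integral_finsetSum fun m _ =>
    Continuous.intervalIntegrable (by fun_prop) _ _]
  refine Finset.sum_congr rfl fun m _ => ?_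
  rw [intervalIntegral.integral_finsetSum fun n _ =>
    Continuous.intervalIntegrable (by fun_prop) _ _]
  simp_rw [intervalIntegral.integral_const_mul]

theorem norm_sum_mul_conj_le (s : Finset ι) (c d : ι → ℂ) :
    ‖∑ n ∈ s, c n * conj (d n)‖ ≤ 1 / 2 * (∑ n ∈ s, ‖c n‖ ^ 2 + ∑ n ∈ s, ‖d n‖ ^ 2) := by
  rw [← Finset.sum_add_distrib, Finset.mul_sum]
  refine norm_sum_le_of_le s fun n _ => ?_
  rw [norm_mul, RCLike.norm_conj]
  nlinarith [sq_nonneg (‖c n‖ - ‖d n‖)]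

theorem sum_sum_mul_mul_le_of_schur {κ : ι → ι → ℝ} (hκ : ∀ m n, 0 ≤ κ m n) {s : Finset ι}
    (hrow : ∀ m ∈ s, ∑ n ∈ s, κ m n ≤ K) (hcol : ∀ n ∈ s, ∑ m ∈ s, κ m n ≤ K) (x y : ι → ℝ) :
    ∑ m ∈ s, ∑ n ∈ s, x m * y n * κ m n ≤ K / 2 * (∑ n ∈ s, x n ^ 2 + ∑ n ∈ s, y n ^ 2) :=
  calc ∑ m ∈ s, ∑ n ∈ s, x m * y n * κ m n
      ≤ ∑ m ∈ s, ∑ n ∈ s, 1 / 2 * (x m ^ 2 * κ m n + y n ^ 2 * κ m n) := by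
        refine Finset.sum_le_sum fun m _ => Finset.sum_le_sum fun n _ => ?_
        nlinarith [mul_nonneg (sq_nonneg (x m - y n)) (hκ m n)]
    _ = 1 / 2 * (∑ m ∈ s, x m ^ 2 * ∑ n ∈ s, κ m n + ∑ n ∈ s, y n ^ 2 * ∑ m ∈ s, κ m n) := by
        simp_rw [← Finset.mul_sum, Finset.sum_add_distrib]
        rw [Finset.sum_comm (f := fun m n => y n ^ 2 * κ m n)]
        simp_rw [← Finset.mul_sum]
    _ ≤ 1 / 2 * (∑ m ∈ s, x m ^ 2 * K + ∑ n ∈ s, y n ^ 2 * K) := by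
        gcongr with m hm n hn
        · exact hrow m hm
        · exact hcol n hn
    _ = K / 2 * (∑ n ∈ s, x n ^ 2 + ∑ n ∈ s, y n ^ 2) := by
        rw [← Finset.sum_mul, ← Finset.sum_mul]; ring

namespace SquareSeparated

variable (hν : SquareSeparated ν K)

include hν

theorem norm_form_sub_diag_le {M : ℝ} (hM : 0 ≤ M) {J : ι → ι → ℂ} {g : ℂ}
    (hdiag : ∀ n, J n n = g) (hoff : ∀ m n, m ≠ n → ‖J m n‖ ≤ M * (1 / (ν m - ν n) ^ 2))
    (s : Finset ι) (c d : ι → ℂ) :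
    ‖∑ m ∈ s, ∑ n ∈ s, c m * conj (d n) * J m n - g * ∑ n ∈ s, c n * conj (d n)‖ ≤
      M * K / 2 * (∑ n ∈ s, ‖c n‖ ^ 2 + ∑ n ∈ s, ‖d n‖ ^ 2) := by
  classical
  have hkernel (m n : ι) : ‖J m n - if m = n then g else 0‖ ≤ M * (1 / (ν m - ν n) ^ 2) := by
    rcases eq_or_ne m n with rfl | hmn
    · simp [hdiag]
    · simpa [hmn] using hoff m n hmn
  have hsplit : ∑ m ∈ s, ∑ n ∈ s, c m * conj (d n) * J m n - g * ∑ n ∈ s, c n * conj (d n) =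
      ∑ m ∈ s, ∑ n ∈ s, c m * conj (d n) * (J m n - if m = n then g else 0) := by
    simp only [mul_sub, Finset.sum_sub_distrib, mul_ite, mul_zero, Finset.sum_ite_eq]
    rw [Finset.sum_ite_mem, Finset.inter_self, mul_comm g, Finset.sum_mul]
  have hsym (m n : ι) : 1 / (ν m - ν n) ^ 2 = 1 / (ν n - ν m) ^ 2 := by rw [sub_sq_comm]
  have hschur := sum_sum_mul_mul_le_of_schur (κ := fun m n => 1 / (ν m - ν n) ^ 2)
    (fun m n => by positivity) (fun m _ => by simpa only [hsym m] using hν.sum_le m s)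
    (fun n _ => hν.sum_le n s) (fun n => ‖c n‖) (fun n => ‖d n‖)
  rw [hsplit]
  calc ‖∑ m ∈ s, ∑ n ∈ s, c m * conj (d n) * (J m n - if m = n then g else 0)‖
      ≤ ∑ m ∈ s, ∑ n ∈ s, ‖c m * conj (d n) * (J m n - if m = n then g else 0)‖ :=
        (norm_sum_le _ _).trans (Finset.sum_le_sum fun m _ => norm_sum_le _ _)
    _ ≤ ∑ m ∈ s, ∑ n ∈ s, M * (‖c m‖ * ‖d n‖ * (1 / (ν m - ν n) ^ 2)) := by
        refine Finset.sum_le_sum fun m _ => Finset.sum_le_sum fun n _ => ?_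
        rw [norm_mul, norm_mul, RCLike.norm_conj, mul_left_comm]
        gcongr
        exact hkernel m n
    _ ≤ M * (K / 2 * (∑ n ∈ s, ‖c n‖ ^ 2 + ∑ n ∈ s, ‖d n‖ ^ 2)) := by
        simp_rw [← Finset.mul_sum]
        gcongr
    _ = _ := by ring

theorem abs_integral_bump_expSum_sub_le {a b : ℝ} (hab : a ≤ b) (s : Finset ι) (c : ι → ℂ) :
    |(∫ t in a..b, bump a b t * ‖expSum ν s c t‖ ^ 2) - (b - a) ^ 5 / 30 * ∑ n ∈ s, ‖c n‖ ^ 2| ≤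
      2 * (b - a) ^ 3 * K * ∑ n ∈ s, ‖c n‖ ^ 2 := by
  have h := hν.norm_form_sub_diag_le (M := 2 * (b - a) ^ 3) (g := ((b - a) ^ 5 / 30 : ℝ))
    (by have := sub_nonneg.2 hab; positivity)
    (fun n => by rw [← integral_bump, ← intervalIntegral.integral_ofReal]; simp)
    (fun m n hmn => norm_integral_bump_exp_le hab (sub_ne_zero.2 (hν.injective.ne hmn))) s c c
  rw [← integral_mul_expSum_mul_conj (continuous_bump a b)] at h
  simp only [mul_conj_self_eq, ← Complex.ofReal_mul, ← Complex.ofReal_sum,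
    intervalIntegral.integral_ofReal, ← Complex.ofReal_sub, Complex.norm_real,
    Real.norm_eq_abs] at h
  exact h.trans (le_of_eq (by ring))

theorem sum_norm_sq_le_integral_expSum {a b : ℝ} (hab : a < b) (hL : 120 * K ≤ (b - a) ^ 2)
    (s : Finset ι) (c : ι → ℂ) :
    ∑ n ∈ s, ‖c n‖ ^ 2 ≤ 4 / (b - a) * ∫ t in a..b, ‖expSum ν s c t‖ ^ 2 := by
  have hpos := sub_pos.2 hab
  set S := ∑ n ∈ s, ‖c n‖ ^ 2
  set F := ∫ t in a..b, ‖expSum ν s c t‖ ^ 2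
  have hupper : ∫ t in a..b, bump a b t * ‖expSum ν s c t‖ ^ 2 ≤ (b - a) ^ 4 / 16 * F := by
    rw [← intervalIntegral.integral_const_mul]
    refine intervalIntegral.integral_mono_on hab.le
      (Continuous.intervalIntegrable (by fun_prop) _ _)
      (Continuous.intervalIntegrable (by fun_prop) _ _) fun t ht => ?_
    gcongr
    calc bump a b t = ((t - a) * (b - t)) ^ 2 := by unfold bump; ring
      _ ≤ ((b - a) ^ 2 / 4) ^ 2 := by
        have := mul_nonneg (sub_nonneg.2 ht.1) (sub_nonneg.2 ht.2)
        gcongr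
        nlinarith [sq_nonneg (b + a - 2 * t)]
      _ = (b - a) ^ 4 / 16 := by ring
  have hlower : (b - a) ^ 5 / 60 * S ≤ ∫ t in a..b, bump a b t * ‖expSum ν s c t‖ ^ 2 := by
    have herror : 2 * (b - a) ^ 3 * K * S ≤ (b - a) ^ 5 / 60 * S := by
      gcongr
      nlinarith [mul_le_mul_of_nonneg_left hL (pow_pos hpos 3).le]
    linarith [(abs_le.1 (hν.abs_integral_bump_expSum_sub_le hab.le s c)).1]
  have hF : 0 ≤ F := intervalIntegral.integral_nonneg hab.le fun t _ => by positivity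
  have hscaled : (b - a) ^ 4 * ((b - a) * S) ≤ (b - a) ^ 4 * (4 * F) := by
    nlinarith [mul_nonneg (pow_pos hpos 4).le hF]
  rw [div_mul_eq_mul_div, le_div_iff₀ hpos]
  linarith [le_of_mul_le_mul_left hscaled (pow_pos hpos 4)]

theorem integral_expSum_le (s : Finset ι) (c : ι → ℂ) :
    ∫ t in (0 : ℝ)..1, ‖expSum ν s c t‖ ^ 2 ≤ (9 + 54 * K) * ∑ n ∈ s, ‖c n‖ ^ 2 := by
  have hbump := (abs_le.1
    (hν.abs_integral_bump_expSum_sub_le (a := -1) (b := 2) (by norm_num) s c)).2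
  have hweight : ∫ t in (0 : ℝ)..1, ‖expSum ν s c t‖ ^ 2 ≤
      ∫ t in (0 : ℝ)..1, bump (-1) 2 t * ‖expSum ν s c t‖ ^ 2 := by
    refine intervalIntegral.integral_mono_on zero_le_one
      (Continuous.intervalIntegrable (by fun_prop) _ _)
      (Continuous.intervalIntegrable (by fun_prop) _ _) fun t ht => ?_
    refine le_mul_of_one_le_left (by positivity) ?_
    calc (1 : ℝ) ≤ ((t - -1) * (2 - t)) ^ 2 := one_le_pow₀ (by nlinarith [ht.1, ht.2])
      _ = bump (-1) 2 t := by unfold bump; ring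
  have hextend : ∫ t in (0 : ℝ)..1, bump (-1) 2 t * ‖expSum ν s c t‖ ^ 2 ≤
      ∫ t in (-1 : ℝ)..2, bump (-1) 2 t * ‖expSum ν s c t‖ ^ 2 :=
    intervalIntegral.integral_mono_interval (by norm_num) zero_le_one (by norm_num)
      (Eventually.of_forall fun t => by simp only [bump, Pi.zero_apply]; positivity)
      (Continuous.intervalIntegrable (by fun_prop) _ _)
  have : 0 ≤ ∑ n ∈ s, ‖c n‖ ^ 2 := by positivity
  nlinarith

theorem norm_integral_ramp_expSum_mul_conj_le (s : Finset ι) (c d : ι → ℂ) :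
    ‖∫ t in (0 : ℝ)..1, ((1 - t : ℝ) : ℂ) * (expSum ν s c t * conj (expSum ν s d t))‖ ≤
      (9 + 54 * K) / 2 * (∑ n ∈ s, ‖c n‖ ^ 2 + ∑ n ∈ s, ‖d n‖ ^ 2) :=
  calc ‖∫ t in (0 : ℝ)..1, ((1 - t : ℝ) : ℂ) * (expSum ν s c t * conj (expSum ν s d t))‖
      ≤ ∫ t in (0 : ℝ)..1, ‖((1 - t : ℝ) : ℂ) * (expSum ν s c t * conj (expSum ν s d t))‖ :=
        intervalIntegral.norm_integral_le_integral_norm zero_le_one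
    _ ≤ ∫ t in (0 : ℝ)..1, (1 / 2 * ‖expSum ν s c t‖ ^ 2 + 1 / 2 * ‖expSum ν s d t‖ ^ 2) := by
        refine intervalIntegral.integral_mono_on zero_le_one
          (Continuous.intervalIntegrable (by fun_prop) _ _)
          (Continuous.intervalIntegrable (by fun_prop) _ _) fun t ht => ?_
        rw [norm_mul, norm_mul, RCLike.norm_conj, Complex.norm_real, Real.norm_eq_abs,
          abs_of_nonneg (sub_nonneg.2 ht.2)]
        have h1 : 1 - t ≤ 1 := by linarith [ht.1]
        have h2 : 0 ≤ ‖expSum ν s c t‖ * ‖expSum ν s d t‖ := by positivity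
        nlinarith [sq_nonneg (‖expSum ν s c t‖ - ‖expSum ν s d t‖)]
    _ = 1 / 2 * (∫ t in (0 : ℝ)..1, ‖expSum ν s c t‖ ^ 2) +
        1 / 2 * ∫ t in (0 : ℝ)..1, ‖expSum ν s d t‖ ^ 2 := by
        rw [intervalIntegral.integral_add (Continuous.intervalIntegrable (by fun_prop) _ _)
          (Continuous.intervalIntegrable (by fun_prop) _ _), intervalIntegral.integral_const_mul,
          intervalIntegral.integral_const_mul]
    _ ≤ (9 + 54 * K) / 2 * (∑ n ∈ s, ‖c n‖ ^ 2 + ∑ n ∈ s, ‖d n‖ ^ 2) := by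
        linarith [hν.integral_expSum_le s c, hν.integral_expSum_le s d]

theorem norm_hilbert_form_le (s : Finset ι) (c d : ι → ℂ) :
    ‖∑ m ∈ s, ∑ n ∈ s, c m * conj (d n) * ((1 / (ν m - ν n) : ℝ) : ℂ)‖ ≤
      (5 + 28 * K) * (∑ n ∈ s, ‖c n‖ ^ 2 + ∑ n ∈ s, ‖d n‖ ^ 2) := by
  -- `∫₀¹ (1 - t) e^{ixt} dt = i / x + O(1 / x²)`: up to an error that the Schur test controls, the
  -- Hilbert kernel is the Gram kernel of the weight `1 - t`.
  set ramp : ℝ → ℂ := fun x =>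
    ∫ t in (0 : ℝ)..1, ((1 - t : ℝ) : ℂ) * Complex.exp (x * t * Complex.I)
  have herror := hν.norm_form_sub_diag_le (g := 1 / 2) zero_le_two
    (J := fun m n => ramp (ν m - ν n) - Complex.I * ((1 / (ν m - ν n) : ℝ) : ℂ))
    (fun n => by
      simp only [ramp, sub_self, Complex.ofReal_zero, zero_mul, Complex.exp_zero, mul_one,
        div_zero, mul_zero, sub_zero, intervalIntegral.integral_ofReal, integral_ramp]
      norm_num)
    (fun m n hmn => norm_integral_ramp_exp_sub_le (sub_ne_zero.2 (hν.injective.ne hmn))) s c d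
  have hdiag : ‖(1 / 2 : ℂ) * ∑ n ∈ s, c n * conj (d n)‖ ≤
      1 / 4 * (∑ n ∈ s, ‖c n‖ ^ 2 + ∑ n ∈ s, ‖d n‖ ^ 2) := by
    rw [norm_mul, show ‖(1 / 2 : ℂ)‖ = 1 / 2 by norm_num]
    linarith [norm_sum_mul_conj_le s c d]
  have hramp := hν.norm_integral_ramp_expSum_mul_conj_le s c d
  rw [integral_mul_expSum_mul_conj (by fun_prop)] at hramp
  simp only [mul_sub, Finset.sum_sub_distrib] at herror
  simp_rw [mul_left_comm _ Complex.I, ← Finset.mul_sum] at herror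
  set B := ∑ m ∈ s, ∑ n ∈ s, c m * conj (d n) * ((1 / (ν m - ν n) : ℝ) : ℂ)
  set R := ∑ m ∈ s, ∑ n ∈ s, c m * conj (d n) * ramp (ν m - ν n)
  set D := (1 / 2 : ℂ) * ∑ n ∈ s, c n * conj (d n)
  have htriangle : ‖B‖ ≤ ‖R‖ + ‖D‖ + ‖R - Complex.I * B - D‖ :=
    calc ‖B‖ = ‖R - D - (R - Complex.I * B - D)‖ := by
          rw [show R - D - (R - Complex.I * B - D) = Complex.I * B by ring, norm_mul,
            Complex.norm_I, one_mul]
      _ ≤ _ := (norm_sub_le _ _).trans (by gcongr; exact norm_sub_le R D)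
  have : 0 ≤ ∑ n ∈ s, ‖c n‖ ^ 2 + ∑ n ∈ s, ‖d n‖ ^ 2 := by positivity
  nlinarith

theorem sum_norm_sq_hilbert_le (s : Finset ι) (c : ι → ℂ) :
    ∑ n ∈ s, ‖∑ m ∈ s, c m * ((1 / (ν m - ν n) : ℝ) : ℂ)‖ ^ 2 ≤
      4 * (5 + 28 * K) ^ 2 * ∑ n ∈ s, ‖c n‖ ^ 2 := by
  set C := 5 + 28 * K
  have hC : 0 < C := by have := hν.nonneg; positivity
  set y : ι → ℂ := fun n => ∑ m ∈ s, c m * ((1 / (ν m - ν n) : ℝ) : ℂ)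
  -- Duality: pair the transform `y` of `c` with `y / (2 C)`.
  have hform := hν.norm_hilbert_form_le s c fun n => ((1 / (2 * C) : ℝ) : ℂ) * y n
  have hpair : ∑ m ∈ s, ∑ n ∈ s, c m * conj (((1 / (2 * C) : ℝ) : ℂ) * y n) *
      ((1 / (ν m - ν n) : ℝ) : ℂ) = ((1 / (2 * C) * ∑ n ∈ s, ‖y n‖ ^ 2 : ℝ) : ℂ) := by
    rw [Finset.sum_comm, Complex.ofReal_mul, Complex.ofReal_sum, Finset.mul_sum]
    refine Finset.sum_congr rfl fun n _ => ?_
    simp_rw [← mul_conj_self_eq, map_mul, Complex.conj_ofReal, mul_right_comm (c _),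
      ← Finset.sum_mul]
    exact mul_left_comm _ _ _
  have hscale : ∑ n ∈ s, ‖((1 / (2 * C) : ℝ) : ℂ) * y n‖ ^ 2 =
      (1 / (2 * C)) ^ 2 * ∑ n ∈ s, ‖y n‖ ^ 2 := by
    simp only [norm_mul, Complex.norm_real, mul_pow, Real.norm_eq_abs, sq_abs, Finset.mul_sum]
  rw [hpair, hscale, Complex.norm_real, Real.norm_eq_abs] at hform
  have hquad : 1 / (2 * C) * ∑ n ∈ s, ‖y n‖ ^ 2 ≤
      C * (∑ n ∈ s, ‖c n‖ ^ 2 + (1 / (2 * C)) ^ 2 * ∑ n ∈ s, ‖y n‖ ^ 2) :=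
    (le_abs_self _).trans hform
  field_simp at hquad
  change ∑ n ∈ s, ‖y n‖ ^ 2 ≤ _
  linarith

end SquareSeparated

end ExponentialSums

section SquareSummable

variable {ι : Type*}

theorem norm_sq_le_two_mul_add (y z : ℂ) : ‖y‖ ^ 2 ≤ 2 * ‖z‖ ^ 2 + 2 * ‖y - z‖ ^ 2 := by
  have := norm_le_norm_add_norm_sub' y z
  nlinarith [sq_nonneg (‖z‖ - ‖y - z‖), norm_nonneg y]

theorem norm_sum_mul_sq_le (z w : ι → ℂ) (s : Finset ι) :
    ‖∑ n ∈ s, z n * w n‖ ^ 2 ≤ (∑ n ∈ s, ‖z n‖ ^ 2) * ∑ n ∈ s, ‖w n‖ ^ 2 :=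
  calc ‖∑ n ∈ s, z n * w n‖ ^ 2 ≤ (∑ n ∈ s, ‖z n‖ * ‖w n‖) ^ 2 := by
        gcongr
        exact norm_sum_le_of_le s fun n _ => norm_mul_le _ _
    _ ≤ _ := Finset.sum_mul_sq_le_sq_mul_sq _ _ _

theorem hasSum_norm_sq (x : ℓ²(ι, ℂ)) : HasSum (fun n => ‖x n‖ ^ 2) (‖x‖ ^ 2) := by
  simpa using lp.hasSum_norm (p := 2) (by norm_num) x

theorem sum_norm_sq_le (x : ℓ²(ι, ℂ)) (s : Finset ι) : ∑ n ∈ s, ‖x n‖ ^ 2 ≤ ‖x‖ ^ 2 :=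
  sum_le_hasSum s (fun n _ => sq_nonneg ‖x n‖) (hasSum_norm_sq x)

theorem norm_sq_le_of_forall_sum_le {x : ℓ²(ι, ℂ)} {C : ℝ}
    (h : ∀ s : Finset ι, ∑ n ∈ s, ‖x n‖ ^ 2 ≤ C) : ‖x‖ ^ 2 ≤ C :=
  le_of_tendsto (hasSum_norm_sq x) (Eventually.of_forall h)

theorem norm_inner_sub_sum_inner_sq_le (x y : ℓ²(ι, ℂ)) (s : Finset ι) :
    ‖⟪x, y⟫_ℂ - ∑ n ∈ s, ⟪x n, y n⟫_ℂ‖ ^ 2 ≤ ‖x‖ ^ 2 * (‖y‖ ^ 2 - ∑ n ∈ s, ‖y n‖ ^ 2) := by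
  classical
  have hinner : ⟪x, y⟫_ℂ - ∑ n ∈ s, ⟪x n, y n⟫_ℂ = ⟪x, y - ∑ n ∈ s, lp.single 2 n (y n)⟫_ℂ := by
    simp only [inner_sub_right, inner_sum, lp.inner_single_right]
  have hnorm : ‖y - ∑ n ∈ s, lp.single 2 n (y n)‖ ^ 2 = ‖y‖ ^ 2 - ∑ n ∈ s, ‖y n‖ ^ 2 := by
    simpa using lp.norm_compl_sum_single (p := 2) (by norm_num) y s
  rw [hinner, ← hnorm, ← mul_pow]
  gcongr
  exact norm_inner_le_norm _ _

theorem tendstoUniformlyOn_sum_inner {S : Set ℝ} (hS : IsCompact S) {x y : ℝ → ℓ²(ι, ℂ)}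
    (hx : ContinuousOn x S) (hy : ContinuousOn y S) :
    TendstoUniformlyOn (fun s t => ∑ n ∈ s, ⟪x t n, y t n⟫_ℂ) (fun t => ⟪x t, y t⟫_ℂ) atTop S := by
  have hdini : TendstoUniformlyOn (fun (s : Finset ι) t => ∑ n ∈ s, ‖y t n‖ ^ 2)
      (fun t => ‖y t‖ ^ 2) atTop S :=
    Monotone.tendstoUniformlyOn_of_forall_tendsto hS
      (fun s => continuousOn_finsetSum s fun n _ =>
        (((lp.evalCLM ℂ _ 2 n).continuous.comp_continuousOn hy).norm.pow 2))
      (fun t _ s s' h => Finset.sum_le_sum_of_subset_of_nonneg h fun n _ _ => sq_nonneg ‖y t n‖)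
      (hy.norm.pow 2) fun t _ => hasSum_norm_sq (y t)
  obtain ⟨M, hM⟩ := hS.exists_bound_of_continuousOn hx
  rw [Metric.tendstoUniformlyOn_iff] at hdini ⊢
  intro ε hε
  filter_upwards [hdini (ε ^ 2 / (M ^ 2 + 1)) (by positivity)] with s hs t ht
  have htail : ‖y t‖ ^ 2 - ∑ n ∈ s, ‖y t n‖ ^ 2 < ε ^ 2 / (M ^ 2 + 1) :=
    (le_abs_self _).trans_lt (hs t ht)
  rw [dist_eq_norm]
  refine lt_of_pow_lt_pow_left₀ 2 hε.le ?_
  calc _ ≤ ‖x t‖ ^ 2 * (‖y t‖ ^ 2 - ∑ n ∈ s, ‖y t n‖ ^ 2) := norm_inner_sub_sum_inner_sq_le _ _ s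
    _ ≤ M ^ 2 * (ε ^ 2 / (M ^ 2 + 1)) := by
      gcongr
      · exact sub_nonneg.2 (sum_norm_sq_le _ s)
      · exact hM t ht
    _ < ε ^ 2 := by
      rw [mul_div_assoc', div_lt_iff₀ (by positivity)]
      nlinarith [sq_pos_of_pos hε]

theorem norm_mul_le_norm_ofReal_mul {z : ℂ} {C : ℝ} (hz : ‖z‖ ≤ C) (w : ℂ) :
    ‖z * w‖ ≤ ‖(C : ℂ) * w‖ := by
  rw [norm_mul, norm_mul, Complex.norm_real]
  gcongr
  exact hz.trans (le_abs_self C)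

/-- The operator on `ℓ²` that multiplies the `n`-th entry by `g n`, where `g` is bounded. -/
noncomputable def diagonal {g : ι → ℂ} {C : ℝ} (hg : ∀ n, ‖g n‖ ≤ C) :
    ℓ²(ι, ℂ) →L[ℂ] ℓ²(ι, ℂ) :=
  LinearMap.mkContinuous
    { toFun x := ⟨fun n => g n * x n,
        ((lp.memℓp x).const_mul (C : ℂ)).mono' fun n => norm_mul_le_norm_ofReal_mul (hg n) _⟩
      map_add' x y := by ext n; exact mul_add _ _ _
      map_smul' c x := by ext n; exact mul_left_comm _ _ _ }
    |C| fun x => by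
      rw [← Real.norm_eq_abs, ← Complex.norm_real, ← norm_smul]
      exact lp.norm_mono two_ne_zero fun n => norm_mul_le_norm_ofReal_mul (hg n) _

section Diagonal

variable {g : ι → ℂ} {C : ℝ} (hg : ∀ n, ‖g n‖ ≤ C) (x : ℓ²(ι, ℂ))

@[simp]
theorem diagonal_apply (n : ι) : diagonal hg x n = g n * x n := rfl

theorem norm_diagonal_sq_le : ‖diagonal hg x‖ ^ 2 ≤ C ^ 2 * ‖x‖ ^ 2 := by
  rw [← sq_abs C, ← mul_pow]
  gcongr
  exact (diagonal hg).le_of_opNorm_le (LinearMap.mkContinuous_norm_le _ (abs_nonneg C) _) x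

end Diagonal

/-- The coordinatewise multiplication by `β`, an operator on `ℓ²`. -/
noncomputable def coupling (β : ℓ²(ι, ℂ)) : ℓ²(ι, ℂ) →L[ℂ] ℓ²(ι, ℂ) :=
  diagonal (lp.norm_apply_le_norm two_ne_zero β)

@[simp]
theorem coupling_apply (β x : ℓ²(ι, ℂ)) (n : ι) : coupling β x n = β n * x n := rfl

theorem norm_coupling_sq_le (β x : ℓ²(ι, ℂ)) : ‖coupling β x‖ ^ 2 ≤ ‖β‖ ^ 2 * ‖x‖ ^ 2 :=
  norm_diagonal_sq_le _ x

theorem norm_inner_coupling_le (β x y : ℓ²(ι, ℂ)) :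
    ‖⟪coupling β x, y⟫_ℂ‖ ≤ ‖x‖ * ‖coupling β y‖ := by
  set y' := diagonal (g := fun n => conj (β n)) (C := ‖β‖)
    (fun n => by rw [RCLike.norm_conj]; exact lp.norm_apply_le_norm two_ne_zero β n) y
  have hinner : ⟪coupling β x, y⟫_ℂ = ⟪x, y'⟫_ℂ := by
    simp_rw [lp.inner_eq_tsum]
    refine tsum_congr fun n => ?_
    simp [y']; ring
  have hnorm : ‖y'‖ ≤ ‖coupling β y‖ := lp.norm_mono two_ne_zero fun n => by simp [y']
  rw [hinner]
  exact (norm_inner_le_norm _ _).trans (by gcongr)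

end SquareSummable

section Duhamel

variable {a b : ℝ}

theorem sq_integral_le (hab : a ≤ b) {g : ℝ → ℝ} (hg : ContinuousOn g (Set.Icc a b)) :
    (∫ t in a..b, g t) ^ 2 ≤ (b - a) * ∫ t in a..b, g t ^ 2 := by
  rcases hab.eq_or_lt with rfl | hlt
  · simp
  have := sub_pos.2 hlt
  set mean := (∫ t in a..b, g t) / (b - a) with hmean
  have hint : IntervalIntegrable g volume a b := hg.intervalIntegrable_of_Icc hab
  have hint_sq : IntervalIntegrable (fun t => g t ^ 2) volume a b :=
    (hg.pow 2).intervalIntegrable_of_Icc hab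
  have hvariance : ∫ t in a..b, (g t - mean) ^ 2 =
      (∫ t in a..b, g t ^ 2) - 2 * mean * (∫ t in a..b, g t) + (b - a) * mean ^ 2 := by
    have hexpand (t : ℝ) : (g t - mean) ^ 2 = (g t ^ 2 - 2 * mean * g t) + mean ^ 2 := by ring
    simp_rw [hexpand]
    rw [intervalIntegral.integral_add (hint_sq.sub (hint.const_mul _)) (by simp),
      intervalIntegral.integral_sub hint_sq (hint.const_mul _),
      intervalIntegral.integral_const_mul, intervalIntegral.integral_const, smul_eq_mul]
  have hnonneg : 0 ≤ ∫ t in a..b, (g t - mean) ^ 2 :=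
    intervalIntegral.integral_nonneg hab fun t _ => sq_nonneg _
  have htotal : ∫ t in a..b, g t = (b - a) * mean := by rw [hmean]; field_simp
  rw [hvariance, htotal] at hnonneg
  rw [htotal]
  nlinarith

theorem integral_mono_subinterval {c d : ℝ} (hca : c ≤ a) (hab : a ≤ b) (hbd : b ≤ d)
    {g : ℝ → ℝ} (hg : ContinuousOn g (Set.Icc c d)) (hg0 : ∀ t ∈ Set.Icc c d, 0 ≤ g t) :
    ∫ t in a..b, g t ≤ ∫ t in c..d, g t := by
  refine intervalIntegral.integral_mono_interval hca hab hbd ?_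
    (hg.intervalIntegrable_of_Icc (hca.trans (hab.trans hbd)))
  filter_upwards [ae_restrict_mem measurableSet_Ioc] with t ht
  exact hg0 t (Set.Ioc_subset_Icc_self ht)

variable {ν : ℝ} {f x : ℝ → ℂ}

theorem norm_sub_exp_mul_sq_le (hab : a ≤ b) (hf : ContinuousOn f (Set.Icc a b))
    (hx : ContinuousOn x (Set.Icc a b))
    (hderiv : ∀ t ∈ Set.Ioo a b, HasDerivAt x (Complex.I * ν * x t + f t) t) :
    ‖x b - Complex.exp (ν * (b - a : ℝ) * Complex.I) * x a‖ ^ 2 ≤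
      (b - a) * ∫ t in a..b, ‖f t‖ ^ 2 := by
  set e : ℝ → ℂ := fun t => Complex.exp ((-ν : ℝ) * t * Complex.I) with he
  have he_cont : ContinuousOn e (Set.Icc a b) := by fun_prop
  have hduhamel : ∫ t in a..b, e t * f t = e b * x b - e a * x a :=
    intervalIntegral.integral_eq_sub_of_hasDerivAt_of_le hab (he_cont.mul hx)
      (fun t ht => by
        convert! (hasDerivAt_exp_mul_I (-ν) t).mul (hderiv t ht) using 1
        simp only [he, Complex.ofReal_neg]; ring)
      ((he_cont.mul hf).intervalIntegrable_of_Icc hab)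
  have hrotate : ‖x b - Complex.exp (ν * (b - a : ℝ) * Complex.I) * x a‖ =
      ‖∫ t in a..b, e t * f t‖ := by
    rw [hduhamel, ← one_mul ‖x b - _‖, ← norm_exp_mul_I (-ν) b, ← norm_mul, mul_sub, ← mul_assoc,
      ← Complex.exp_add]
    congr 5
    push_cast; ring
  have htriangle : ‖∫ t in a..b, e t * f t‖ ≤ ∫ t in a..b, ‖f t‖ := by
    refine (intervalIntegral.norm_integral_le_integral_norm hab).trans (le_of_eq ?_)
    simp only [he, norm_mul, norm_exp_mul_I, one_mul]
  rw [hrotate]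
  exact (by gcongr : _ ≤ (∫ t in a..b, ‖f t‖) ^ 2).trans (sq_integral_le hab hf.norm)

end Duhamel

theorem sum_integral_norm_sq_le {ι : Type*} {a b : ℝ} (hab : a ≤ b) {f : ℝ → ℓ²(ι, ℂ)}
    (hf : ContinuousOn f (Set.Icc a b)) (s : Finset ι) :
    ∑ n ∈ s, ∫ t in a..b, ‖f t n‖ ^ 2 ≤ ∫ t in a..b, ‖f t‖ ^ 2 := by
  have hcont (n : ι) : ContinuousOn (fun t => ‖f t n‖ ^ 2) (Set.Icc a b) :=
    ((lp.evalCLM ℂ _ 2 n).continuous.comp_continuousOn hf).norm.pow 2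
  have hsum := intervalIntegral.integral_finsetSum (s := s) fun n _ =>
    (hcont n).intervalIntegrable_of_Icc (μ := volume) hab
  rw [← hsum]
  exact intervalIntegral.integral_mono_on hab
    ((continuousOn_finsetSum s fun n _ => hcont n).intervalIntegrable_of_Icc hab)
    ((hf.norm.pow 2).intervalIntegrable_of_Icc hab) fun t _ => sum_norm_sq_le (f t) s

/-- A continuous path `x` in `ℓ²` with `x_n' = i ν_n x_n + f_n` on `(a, b)`, mode by mode, where the
forcing `f` is a continuous path in `ℓ²`. -/
structure IsForcedOscillation {ι : Type*} (ν : ι → ℝ) (a b : ℝ) (f x : ℝ → ℓ²(ι, ℂ)) : Prop where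
  forcing_cont : ContinuousOn f (Set.Icc a b)
  cont : ContinuousOn x (Set.Icc a b)
  hasDerivAt : ∀ n, ∀ t ∈ Set.Ioo a b,
    HasDerivAt (fun t => x t n) (Complex.I * ν n * x t n + f t n) t

namespace IsForcedOscillation

variable {ι : Type*} {ν : ι → ℝ} {a b : ℝ} {f x : ℝ → ℓ²(ι, ℂ)}
  (hx : IsForcedOscillation ν a b f x)

theorem const {w w' : ℓ²(ι, ℂ)} (h : ∀ n, w' n = -(Complex.I * ν n * w n)) (a b : ℝ) :
    IsForcedOscillation ν a b (fun _ => w') fun _ => w where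
  forcing_cont := continuousOn_const
  cont := continuousOn_const
  hasDerivAt n t _ := by simpa [h] using hasDerivAt_const t (w n)

include hx

theorem mono {a' b' : ℝ} (ha : a ≤ a') (hb : b' ≤ b) : IsForcedOscillation ν a' b' f x where
  forcing_cont := hx.forcing_cont.mono (Set.Icc_subset_Icc ha hb)
  cont := hx.cont.mono (Set.Icc_subset_Icc ha hb)
  hasDerivAt n t ht := hx.hasDerivAt n t (Set.Ioo_subset_Ioo ha hb ht)

theorem diagonal {g : ι → ℂ} {C : ℝ} (hg : ∀ n, ‖g n‖ ≤ C) :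
    IsForcedOscillation ν a b (fun t => diagonal hg (f t)) fun t => diagonal hg (x t) where
  forcing_cont := (OscTurnpike.diagonal hg).continuous.comp_continuousOn hx.forcing_cont
  cont := (OscTurnpike.diagonal hg).continuous.comp_continuousOn hx.cont
  hasDerivAt n t ht := by
    convert! (hx.hasDerivAt n t ht).const_mul (g n) using 1
    simp only [diagonal_apply]; ring

theorem continuousOn_apply (n : ι) : ContinuousOn (fun t => x t n) (Set.Icc a b) :=
  (lp.evalCLM ℂ _ 2 n).continuous.comp_continuousOn hx.cont

theorem continuousOn_forcing_apply (n : ι) : ContinuousOn (fun t => f t n) (Set.Icc a b) :=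
  (lp.evalCLM ℂ _ 2 n).continuous.comp_continuousOn hx.forcing_cont

theorem sum_norm_sub_exp_mul_sq_le {r t : ℝ} (har : a ≤ r) (hrt : r ≤ t) (htb : t ≤ b)
    (s : Finset ι) :
    ∑ n ∈ s, ‖x t n - Complex.exp (ν n * (t - r : ℝ) * Complex.I) * x r n‖ ^ 2 ≤
      (b - a) * ∫ t in a..b, ‖f t‖ ^ 2 := by
  have hsub := hx.mono har htb
  have := sub_nonneg.2 hrt
  calc ∑ n ∈ s, ‖x t n - Complex.exp (ν n * (t - r : ℝ) * Complex.I) * x r n‖ ^ 2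
      ≤ ∑ n ∈ s, (t - r) * ∫ t in r..t, ‖f t n‖ ^ 2 := by
        gcongr with n
        exact norm_sub_exp_mul_sq_le hrt (hsub.continuousOn_forcing_apply n)
          (hsub.continuousOn_apply n) (hsub.hasDerivAt n)
    _ ≤ (t - r) * ∫ t in r..t, ‖f t‖ ^ 2 := by
        rw [← Finset.mul_sum]
        gcongr
        exact sum_integral_norm_sq_le hrt hsub.forcing_cont s
    _ ≤ (b - a) * ∫ t in a..b, ‖f t‖ ^ 2 := by
        have hab : 0 ≤ b - a := by linarith
        have hcont : ContinuousOn (fun t => ‖f t‖ ^ 2) (Set.Icc a b) := hx.forcing_cont.norm.pow 2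
        have hmono := integral_mono_subinterval har hrt htb hcont fun t _ => sq_nonneg ‖f t‖
        gcongr
        exact intervalIntegral.integral_nonneg hrt fun t _ => sq_nonneg ‖f t‖

theorem norm_sq_le {t t₀ : ℝ} (ht : t ∈ Set.Icc a b) (ht₀ : t₀ ∈ Set.Icc a b) :
    ‖x t‖ ^ 2 ≤ 2 * ‖x t₀‖ ^ 2 + 2 * ((b - a) * ∫ t in a..b, ‖f t‖ ^ 2) := by
  refine norm_sq_le_of_forall_sum_le fun s => ?_
  have hbase : ∑ n ∈ s, ‖x t₀ n‖ ^ 2 ≤ ‖x t₀‖ ^ 2 := sum_norm_sq_le _ s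
  rcases le_total t₀ t with h | h
  · have hduhamel := hx.sum_norm_sub_exp_mul_sq_le ht₀.1 h ht.2 s
    have hsum := Finset.sum_le_sum fun n (_ : n ∈ s) =>
      norm_sq_le_two_mul_add (x t n) (Complex.exp (ν n * (t - t₀ : ℝ) * Complex.I) * x t₀ n)
    simp only [norm_mul, norm_exp_mul_I, one_mul, Finset.sum_add_distrib,
      ← Finset.mul_sum] at hsum
    linarith
  · have hduhamel := hx.sum_norm_sub_exp_mul_sq_le ht.1 h ht₀.2 s
    have hsum := Finset.sum_le_sum fun n (_ : n ∈ s) =>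
      norm_sq_le_two_mul_add (Complex.exp (ν n * (t₀ - t : ℝ) * Complex.I) * x t n) (x t₀ n)
    simp only [norm_mul, norm_exp_mul_I, one_mul, Finset.sum_add_distrib, ← Finset.mul_sum,
      norm_sub_rev (Complex.exp _ * _)] at hsum
    linarith

theorem mul_norm_sq_le {t : ℝ} (ht : t ∈ Set.Icc a b) :
    (b - a) * ‖x t‖ ^ 2 ≤
      2 * (∫ t in a..b, ‖x t‖ ^ 2) + 2 * ((b - a) ^ 2 * ∫ t in a..b, ‖f t‖ ^ 2) := by
  have hab := ht.1.trans ht.2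
  have hint : IntervalIntegrable (fun t => ‖x t‖ ^ 2) volume a b :=
    (hx.cont.norm.pow 2).intervalIntegrable_of_Icc hab
  have hmono := intervalIntegral.integral_mono_on hab
    (intervalIntegrable_const (c := ‖x t‖ ^ 2)) ((hint.const_mul 2).add intervalIntegrable_const)
    fun t₀ ht₀ => hx.norm_sq_le ht ht₀
  rw [intervalIntegral.integral_add (hint.const_mul 2) intervalIntegrable_const,
    intervalIntegral.integral_const_mul, intervalIntegral.integral_const,
    intervalIntegral.integral_const, smul_eq_mul, smul_eq_mul] at hmono
  linarith

theorem hasDerivAt_inner {g y : ℝ → ℓ²(ι, ℂ)} (hy : IsForcedOscillation ν a b g y) {t : ℝ}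
    (ht : t ∈ Set.Ioo a b) :
    HasDerivAt (fun t => ⟪x t, y t⟫_ℂ) (⟪f t, y t⟫_ℂ + ⟪x t, g t⟫_ℂ) t := by
  have huniform : TendstoUniformlyOn
      (fun s t => (∑ n ∈ s, ⟪f t n, y t n⟫_ℂ) + ∑ n ∈ s, ⟪x t n, g t n⟫_ℂ)
      (fun t => ⟪f t, y t⟫_ℂ + ⟪x t, g t⟫_ℂ) atTop (Set.Ioo a b) :=
    ((tendstoUniformlyOn_sum_inner isCompact_Icc hx.forcing_cont hy.cont).add
      (tendstoUniformlyOn_sum_inner isCompact_Icc hx.cont hy.forcing_cont)).mono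
        Set.Ioo_subset_Icc_self
  refine hasDerivAt_of_tendstoUniformlyOn isOpen_Ioo huniform
    (Eventually.of_forall fun s t ht => ?_) (fun t _ => lp.hasSum_inner (x t) (y t)) ht
  rw [← Finset.sum_add_distrib]
  refine HasDerivAt.fun_sum fun n _ => ?_
  convert! (hx.hasDerivAt n t ht).inner ℂ (hy.hasDerivAt n t ht) using 1
  simp only [RCLike.inner_apply, map_add, map_mul, Complex.conj_I, Complex.conj_ofReal]
  ring

end IsForcedOscillation

section Observability

variable {ι : Type*} {ν : ι → ℝ} {K a b : ℝ} {f x : ℝ → ℓ²(ι, ℂ)}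

theorem SquareSeparated.countable (hν : SquareSeparated ν K) : Countable ι := by
  rcases isEmpty_or_nonempty ι with _ | ⟨⟨n⟩⟩
  · infer_instance
  have hsum : Summable fun m => 1 / (ν m - ν n) ^ 2 :=
    summable_of_sum_le (fun m => by positivity) (hν.sum_le n)
  refine Set.countable_univ_iff.1 ((hsum.countable_support.insert n).mono fun m _ => ?_)
  rcases eq_or_ne m n with rfl | hmn
  · exact Set.mem_insert _ _
  · refine Set.mem_insert_of_mem _ ?_
    have := sub_ne_zero.2 (hν.injective.ne hmn)
    simpa using this

theorem tendsto_integral_norm_sum_inner_sq [Countable ι] (hab : a ≤ b) (γ : ℓ²(ι, ℂ))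
    (hx : ContinuousOn x (Set.Icc a b)) :
    Tendsto (fun s : Finset ι => ∫ t in a..b, ‖∑ n ∈ s, ⟪γ n, x t n⟫_ℂ‖ ^ 2) atTop
      (𝓝 (∫ t in a..b, ‖⟪γ, x t⟫_ℂ‖ ^ 2)) := by
  have hcont (n : ι) : ContinuousOn (fun t => ⟪γ n, x t n⟫_ℂ) (Set.Icc a b) :=
    continuousOn_const.inner ((lp.evalCLM ℂ _ 2 n).continuous.comp_continuousOn hx)
  refine intervalIntegral.tendsto_integral_filter_of_dominated_convergence
    (fun t => ‖γ‖ ^ 2 * ‖x t‖ ^ 2) (Eventually.of_forall fun s => ?_)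
    (Eventually.of_forall fun s => Eventually.of_forall fun t _ => ?_)
    (((hx.norm.pow 2).const_mul _).intervalIntegrable_of_Icc hab)
    (Eventually.of_forall fun t _ =>
      (Tendsto.norm (lp.hasSum_inner (𝕜 := ℂ) γ (x t))).pow 2)
  · rw [Set.uIoc_of_le hab]
    exact (((continuousOn_finsetSum s fun n _ => hcont n).norm.pow 2).mono
      Set.Ioc_subset_Icc_self).aestronglyMeasurable measurableSet_Ioc
  · rw [Real.norm_of_nonneg (by positivity)]
    calc ‖∑ n ∈ s, ⟪γ n, x t n⟫_ℂ‖ ^ 2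
        ≤ (∑ n ∈ s, ‖x t n‖ ^ 2) * ∑ n ∈ s, ‖conj (γ n)‖ ^ 2 := norm_sum_mul_sq_le _ _ s
      _ ≤ ‖x t‖ ^ 2 * ‖γ‖ ^ 2 := by
        simp only [RCLike.norm_conj]
        gcongr <;> exact sum_norm_sq_le _ s
      _ = ‖γ‖ ^ 2 * ‖x t‖ ^ 2 := mul_comm _ _

namespace IsForcedOscillation

variable (hx : IsForcedOscillation ν a b f x) (hν : SquareSeparated ν K) (hab : a < b)
  (hL : 120 * K ≤ (b - a) ^ 2) (γ : ℓ²(ι, ℂ))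

include hx

theorem norm_expSum_sq_le {t : ℝ} (ht : t ∈ Set.Icc a b) (s : Finset ι) :
    ‖expSum ν s (fun n => conj (γ n) * (Complex.exp ((-ν n : ℝ) * a * Complex.I) * x a n)) t‖ ^ 2 ≤
      2 * ‖∑ n ∈ s, ⟪γ n, x t n⟫_ℂ‖ ^ 2
        + 2 * (‖γ‖ ^ 2 * ((b - a) * ∫ t in a..b, ‖f t‖ ^ 2)) := by
  set free : ι → ℂ := fun n => Complex.exp (ν n * (t - a : ℝ) * Complex.I) * x a n
  have hsum : expSum ν s
      (fun n => conj (γ n) * (Complex.exp ((-ν n : ℝ) * a * Complex.I) * x a n)) t =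
      ∑ n ∈ s, conj (γ n) * free n := by
    refine Finset.sum_congr rfl fun n _ => ?_
    have hshift : Complex.exp (ν n * (t - a : ℝ) * Complex.I) =
        Complex.exp ((-ν n : ℝ) * a * Complex.I) * Complex.exp (ν n * t * Complex.I) := by
      rw [← Complex.exp_add]; congr 1; push_cast; ring
    simp only [free, hshift]; ring
  have herror : ‖∑ n ∈ s, conj (γ n) * (x t n - free n)‖ ^ 2 ≤
      ‖γ‖ ^ 2 * ((b - a) * ∫ t in a..b, ‖f t‖ ^ 2) := by
    refine (norm_sum_mul_sq_le _ _ s).trans ?_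
    simp only [RCLike.norm_conj]
    gcongr
    · exact sum_norm_sq_le γ s
    · exact hx.sum_norm_sub_exp_mul_sq_le le_rfl ht.1 ht.2 s
  have hsub : ∑ n ∈ s, conj (γ n) * free n - ∑ n ∈ s, ⟪γ n, x t n⟫_ℂ =
      -∑ n ∈ s, conj (γ n) * (x t n - free n) := by
    rw [← Finset.sum_sub_distrib, ← Finset.sum_neg_distrib]
    refine Finset.sum_congr rfl fun n _ => ?_
    rw [RCLike.inner_apply]; ring
  have h := norm_sq_le_two_mul_add (∑ n ∈ s, conj (γ n) * free n) (∑ n ∈ s, ⟪γ n, x t n⟫_ℂ)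
  rw [hsub, norm_neg] at h
  rw [hsum]
  linarith

include hν hab hL

theorem sum_norm_mul_sq_le (s : Finset ι) :
    ∑ n ∈ s, ‖γ n * x a n‖ ^ 2 ≤
      8 / (b - a) * (∫ t in a..b, ‖∑ n ∈ s, ⟪γ n, x t n⟫_ℂ‖ ^ 2)
        + 8 * (‖γ‖ ^ 2 * ((b - a) * ∫ t in a..b, ‖f t‖ ^ 2)) := by
  have hpos := sub_pos.2 hab
  have hint : IntervalIntegrable (fun t => 2 * ‖∑ n ∈ s, ⟪γ n, x t n⟫_ℂ‖ ^ 2) volume a b :=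
    ((continuousOn_finsetSum s fun n _ => continuousOn_const.inner
      (hx.continuousOn_apply n)).norm.pow 2 |>.const_mul 2).intervalIntegrable_of_Icc hab.le
  have hingham := hν.sum_norm_sq_le_integral_expSum hab hL s
    fun n => conj (γ n) * (Complex.exp ((-ν n : ℝ) * a * Complex.I) * x a n)
  calc ∑ n ∈ s, ‖γ n * x a n‖ ^ 2
      = ∑ n ∈ s, ‖conj (γ n) * (Complex.exp ((-ν n : ℝ) * a * Complex.I) * x a n)‖ ^ 2 := by
        simp only [norm_mul, norm_exp_mul_I, RCLike.norm_conj, one_mul]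
    _ ≤ _ := hingham
    _ ≤ 4 / (b - a) * ∫ t in a..b, (2 * ‖∑ n ∈ s, ⟪γ n, x t n⟫_ℂ‖ ^ 2
        + 2 * (‖γ‖ ^ 2 * ((b - a) * ∫ t in a..b, ‖f t‖ ^ 2))) := by
        gcongr
        exact intervalIntegral.integral_mono_on hab.le
          (Continuous.intervalIntegrable (by fun_prop) _ _) (hint.add intervalIntegrable_const)
          fun t ht => hx.norm_expSum_sq_le γ ht s
    _ = _ := by
        rw [intervalIntegral.integral_add hint intervalIntegrable_const,
          intervalIntegral.integral_const_mul, intervalIntegral.integral_const, smul_eq_mul]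
        field_simp; ring

theorem norm_coupling_sq_le :
    ‖coupling γ (x a)‖ ^ 2 ≤ 8 / (b - a) * (∫ t in a..b, ‖⟪γ, x t⟫_ℂ‖ ^ 2)
      + 8 * (‖γ‖ ^ 2 * ((b - a) * ∫ t in a..b, ‖f t‖ ^ 2)) := by
  have := hν.countable
  exact le_of_tendsto_of_tendsto (hasSum_norm_sq (coupling γ (x a)))
    (((tendsto_integral_norm_sum_inner_sq hab.le γ hx.cont).const_mul _).add_const _)
    (Eventually.of_forall (hx.sum_norm_mul_sq_le hν hab hL γ))

end IsForcedOscillation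

end Observability

/-- The optimality system in modal coordinates: `p' = iν p + ⟪β, q⟫ β` and `q' = iν q + p` on
`(a, b)`, mode by mode, for continuous paths `p` and `q` in `ℓ²`. -/
structure ModalSystem {ι : Type*} (ν : ι → ℝ) (β : ℓ²(ι, ℂ)) (a b : ℝ) (p q : ℝ → ℓ²(ι, ℂ)) :
    Prop where
  p_forced : IsForcedOscillation ν a b (fun t => ⟪β, q t⟫_ℂ • β) p
  q_forced : IsForcedOscillation ν a b p q

/-- The quadratic cost `∫ (‖p‖² + |⟪β, q⟫|²)` of a solution of the modal system. -/
noncomputable def modalEnergy {ι : Type*} (β : ℓ²(ι, ℂ)) (a b : ℝ) (p q : ℝ → ℓ²(ι, ℂ)) : ℝ :=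
  ∫ t in a..b, (‖p t‖ ^ 2 + ‖⟪β, q t⟫_ℂ‖ ^ 2)

namespace ModalSystem

variable {ι : Type*} {ν : ι → ℝ} {K : ℝ} {β : ℓ²(ι, ℂ)} {a b : ℝ} {p q : ℝ → ℓ²(ι, ℂ)}
  (h : ModalSystem ν β a b p q)

include h

theorem mono {a' b' : ℝ} (ha : a ≤ a') (hb : b' ≤ b) : ModalSystem ν β a' b' p q where
  p_forced := h.p_forced.mono ha hb
  q_forced := h.q_forced.mono ha hb

theorem continuousOn_observation : ContinuousOn (fun t => ⟪β, q t⟫_ℂ) (Set.Icc a b) :=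
  continuousOn_const.inner h.q_forced.cont

theorem continuousOn_energyDensity :
    ContinuousOn (fun t => ‖p t‖ ^ 2 + ‖⟪β, q t⟫_ℂ‖ ^ 2) (Set.Icc a b) :=
  (h.p_forced.cont.norm.pow 2).add (h.continuousOn_observation.norm.pow 2)

theorem energy_mono {a' b' : ℝ} (ha : a ≤ a') (hab : a' ≤ b') (hb : b' ≤ b) :
    modalEnergy β a' b' p q ≤ modalEnergy β a b p q :=
  integral_mono_subinterval ha hab hb h.continuousOn_energyDensity fun t _ => by positivity

theorem integral_norm_sq_le_energy (hab : a ≤ b) :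
    ∫ t in a..b, ‖p t‖ ^ 2 ≤ modalEnergy β a b p q :=
  intervalIntegral.integral_mono_on hab ((h.p_forced.cont.norm.pow 2).intervalIntegrable_of_Icc hab)
    (h.continuousOn_energyDensity.intervalIntegrable_of_Icc hab)
    fun _ _ => le_add_of_nonneg_right (sq_nonneg _)

theorem integral_norm_observation_sq_le_energy (hab : a ≤ b) :
    ∫ t in a..b, ‖⟪β, q t⟫_ℂ‖ ^ 2 ≤ modalEnergy β a b p q :=
  intervalIntegral.integral_mono_on hab
    ((h.continuousOn_observation.norm.pow 2).intervalIntegrable_of_Icc hab)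
    (h.continuousOn_energyDensity.intervalIntegrable_of_Icc hab)
    fun _ _ => le_add_of_nonneg_left (sq_nonneg _)

theorem integral_norm_forcing_sq_le_energy (hab : a ≤ b) :
    ∫ t in a..b, ‖⟪β, q t⟫_ℂ • β‖ ^ 2 ≤ ‖β‖ ^ 2 * modalEnergy β a b p q := by
  simp only [norm_smul, mul_pow, intervalIntegral.integral_mul_const]
  rw [mul_comm]
  gcongr
  exact h.integral_norm_observation_sq_le_energy hab

theorem energy_eq (hab : a ≤ b) :
    modalEnergy β a b p q = (⟪p b, q b⟫_ℂ).re - (⟪p a, q a⟫_ℂ).re := by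
  refine intervalIntegral.integral_eq_sub_of_hasDerivAt_of_le hab
    (Complex.continuous_re.comp_continuousOn (h.p_forced.cont.inner h.q_forced.cont))
    (fun t ht => ?_) (h.continuousOn_energyDensity.intervalIntegrable_of_Icc hab)
  convert! (Complex.reCLM.hasFDerivAt.comp_hasDerivAt t
    (h.p_forced.hasDerivAt_inner h.q_forced ht)) using 1
  rw [inner_smul_left, mul_comm, mul_conj_self_eq, inner_self_eq_norm_sq_to_K]
  simp
  norm_cast
  ring

theorem norm_coupling_sq_le_energy (hν : SquareSeparated ν K) (hab : a < b)
    (hL : 120 * K ≤ (b - a) ^ 2) {t : ℝ} (ht : t ∈ Set.Icc a b) :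
    ‖coupling β (q t)‖ ^ 2 ≤
      (16 / (b - a) + 18 * (‖β‖ ^ 2 * (b - a))) * modalEnergy β a b p q := by
  have : 0 < b - a := sub_pos.2 hab
  set E := modalEnergy β a b p q
  have hp := h.integral_norm_sq_le_energy hab.le
  have hforcing : ∫ t in a..b, ‖coupling β (p t)‖ ^ 2 ≤ ‖β‖ ^ 2 * E := by
    have hcont := h.p_forced.cont
    refine (intervalIntegral.integral_mono_on hab.le
      ((((coupling β).continuous.comp_continuousOn hcont).norm.pow 2).intervalIntegrable_of_Icc
        hab.le) (((hcont.norm.pow 2).const_mul _).intervalIntegrable_of_Icc hab.le)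
      fun t _ => norm_coupling_sq_le β (p t)).trans ?_
    rw [intervalIntegral.integral_const_mul]
    exact mul_le_mul_of_nonneg_left hp (sq_nonneg _)
  have hweighted :
      IsForcedOscillation ν a b (fun t => coupling β (p t)) fun t => coupling β (q t) :=
    h.q_forced.diagonal _
  have hstart : ‖coupling β (q a)‖ ^ 2 ≤ 8 / (b - a) * E + 8 * (‖β‖ ^ 2 * ((b - a) * E)) := by
    refine (h.q_forced.norm_coupling_sq_le hν hab hL β).trans ?_
    gcongr
    exact h.integral_norm_observation_sq_le_energy hab.le
  calc ‖coupling β (q t)‖ ^ 2 ≤ 2 * ‖coupling β (q a)‖ ^ 2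
        + 2 * ((b - a) * ∫ t in a..b, ‖coupling β (p t)‖ ^ 2) :=
        hweighted.norm_sq_le ht (Set.left_mem_Icc.2 hab.le)
    _ ≤ 2 * (8 / (b - a) * E + 8 * (‖β‖ ^ 2 * ((b - a) * E)))
        + 2 * ((b - a) * (‖β‖ ^ 2 * E)) := by gcongr
    _ = _ := by ring

end ModalSystem

section Corrector

variable {ι : Type*} {ν : ι → ℝ} {K : ℝ} (hν : SquareSeparated ν K)

namespace SquareSeparated

include hν in
theorem norm_one_div_sub_le (n m : ι) : ‖((1 / (ν m - ν n) : ℝ) : ℂ)‖ ≤ √K := by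
  rw [Complex.norm_real]
  refine Real.abs_le_sqrt ?_
  simpa [div_pow] using hν.sum_le n {m}

/-- The reduced resolvent of `diag(ν)` at its eigenvalue `ν n`. -/
noncomputable def reducedResolvent (n : ι) : ℓ²(ι, ℂ) →L[ℂ] ℓ²(ι, ℂ) :=
  diagonal (hν.norm_one_div_sub_le n)

theorem reducedResolvent_apply (n m : ι) (w : ℓ²(ι, ℂ)) :
    hν.reducedResolvent n w m = ((1 / (ν m - ν n) : ℝ) : ℂ) * w m := rfl

@[simp]
theorem reducedResolvent_apply_self (n : ι) (w : ℓ²(ι, ℂ)) : hν.reducedResolvent n w n = 0 := by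
  simp [reducedResolvent_apply]

theorem inner_reducedResolvent_left (n : ι) (w z : ℓ²(ι, ℂ)) :
    ⟪hν.reducedResolvent n w, z⟫_ℂ = ⟪w, hν.reducedResolvent n z⟫_ℂ := by
  simp_rw [lp.inner_eq_tsum, reducedResolvent_apply, RCLike.inner_apply, map_mul,
    Complex.conj_ofReal]
  exact tsum_congr fun m => by ring

theorem mul_reducedResolvent_apply [DecidableEq ι] (n m : ι) (w : ℓ²(ι, ℂ)) :
    ν m * hν.reducedResolvent n w m =
      ν n * hν.reducedResolvent n w m + w m - (lp.single 2 n (w n) : ℓ²(ι, ℂ)) m := by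
  rcases eq_or_ne m n with rfl | hmn
  · simp
  · have hne : (ν m - ν n : ℂ) ≠ 0 := by exact_mod_cast sub_ne_zero.2 (hν.injective.ne hmn)
    rw [reducedResolvent_apply, lp.single_apply_ne _ _ _ hmn]
    push_cast
    field_simp
    ring

theorem norm_reducedResolvent_sq_le (n : ι) (w : ℓ²(ι, ℂ)) :
    ‖hν.reducedResolvent n w‖ ^ 2 ≤ K * ‖w‖ ^ 2 :=
  (norm_diagonal_sq_le (hν.norm_one_div_sub_le n) w).trans_eq (by rw [Real.sq_sqrt hν.nonneg])

theorem sum_norm_reducedResolvent_sq_le (w : ℓ²(ι, ℂ)) (s : Finset ι) :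
    ∑ n ∈ s, ‖hν.reducedResolvent n w‖ ^ 2 ≤ K * ‖w‖ ^ 2 := by
  refine hasSum_le (fun m => ?_) (hasSum_sum fun n _ => hasSum_norm_sq (hν.reducedResolvent n w))
    ((hasSum_norm_sq w).mul_left K)
  have hterm : ∀ n, ‖hν.reducedResolvent n w m‖ ^ 2 = 1 / (ν n - ν m) ^ 2 * ‖w m‖ ^ 2 := fun n => by
    rw [reducedResolvent_apply, norm_mul, Complex.norm_real, mul_pow, Real.norm_eq_abs, sq_abs,
      div_pow, one_pow, ← neg_sub, neg_sq]
  simp only [hterm, ← Finset.sum_mul]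
  gcongr
  exact hν.sum_le m s

theorem sum_norm_inner_reducedResolvent_sq_le (w z : ℓ²(ι, ℂ)) (s : Finset ι) :
    ∑ n ∈ s, ‖⟪hν.reducedResolvent n w, z⟫_ℂ‖ ^ 2 ≤
      4 * (5 + 28 * K) ^ 2 * ‖coupling w z‖ ^ 2 := by
  refine le_of_tendsto (tendsto_finsetSum s fun n _ =>
    (lp.hasSum_inner (𝕜 := ℂ) (hν.reducedResolvent n w) z).norm.pow 2)
    ((eventually_ge_atTop s).mono fun S hS => ?_)
  calc ∑ n ∈ s, ‖∑ m ∈ S, ⟪hν.reducedResolvent n w m, z m⟫_ℂ‖ ^ 2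
      ≤ ∑ n ∈ S, ‖∑ m ∈ S, ⟪hν.reducedResolvent n w m, z m⟫_ℂ‖ ^ 2 :=
        Finset.sum_le_sum_of_subset_of_nonneg hS fun _ _ _ => sq_nonneg _
    _ = ∑ n ∈ S, ‖∑ m ∈ S, conj (w m) * z m * ((1 / (ν m - ν n) : ℝ) : ℂ)‖ ^ 2 := by
        refine Finset.sum_congr rfl fun n _ => ?_
        congr 2
        refine Finset.sum_congr rfl fun m _ => ?_
        rw [RCLike.inner_apply, reducedResolvent_apply, map_mul, Complex.conj_ofReal]
        ring
    _ ≤ 4 * (5 + 28 * K) ^ 2 * ∑ m ∈ S, ‖conj (w m) * z m‖ ^ 2 :=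
        hν.sum_norm_sq_hilbert_le S _
    _ ≤ _ := by
        gcongr
        simpa only [norm_mul, RCLike.norm_conj, coupling_apply]
          using sum_norm_sq_le (coupling w z) S

end SquareSeparated

theorem IsForcedOscillation.hasDerivAt_inner_reducedResolvent {a b t : ℝ} {f x : ℝ → ℓ²(ι, ℂ)}
    (hx : IsForcedOscillation ν a b f x) (n : ι) (w : ℓ²(ι, ℂ)) (ht : t ∈ Set.Ioo a b) :
    HasDerivAt (fun t => ⟪hν.reducedResolvent n w, x t⟫_ℂ)
      (Complex.I * (ν n * ⟪hν.reducedResolvent n w, x t⟫_ℂ + ⟪w, x t⟫_ℂ - conj (w n) * x t n)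
        + ⟪hν.reducedResolvent n w, f t⟫_ℂ) t := by
  classical
  set r := hν.reducedResolvent n w
  have hr : IsForcedOscillation ν a b
      (fun _ => -Complex.I • ((ν n : ℂ) • r + w - lp.single 2 n (w n))) fun _ => r :=
    .const (fun m => by
      have := hν.mul_reducedResolvent_apply n m w
      simp only [lp.coeFn_smul, lp.coeFn_sub, lp.coeFn_add, Pi.smul_apply, Pi.sub_apply,
        Pi.add_apply, smul_eq_mul]
      linear_combination Complex.I * this) a b
  convert! hr.hasDerivAt_inner hx ht using 2
  rw [inner_smul_left, inner_sub_left, inner_add_left, inner_smul_left, lp.inner_single_left,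
    RCLike.inner_apply]
  simp
  ring

/-- The corrector of the mode `n`: by the choice of the reduced resolvents, its oscillation at
frequency `ν n` absorbs the coupling of the mode `n` to all other modes. -/
noncomputable def corrector (β : ℓ²(ι, ℂ)) (n : ι) (p q : ℓ²(ι, ℂ)) : ℂ :=
  -Complex.I * ⟪hν.reducedResolvent n β, q⟫_ℂ
    + ⟪hν.reducedResolvent n (hν.reducedResolvent n β), p⟫_ℂ

theorem sum_norm_corrector_sq_le (β p q : ℓ²(ι, ℂ)) (s : Finset ι) :
    ∑ n ∈ s, ‖corrector hν β n p q‖ ^ 2 ≤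
      8 * (5 + 28 * K) ^ 2 * ‖coupling β q‖ ^ 2 + 2 * (K ^ 2 * ‖β‖ ^ 2) * ‖p‖ ^ 2 := by
  set R := hν.reducedResolvent
  have hsecond : ∑ n ∈ s, ‖⟪R n (R n β), p⟫_ℂ‖ ^ 2 ≤ K ^ 2 * ‖β‖ ^ 2 * ‖p‖ ^ 2 :=
    calc ∑ n ∈ s, ‖⟪R n (R n β), p⟫_ℂ‖ ^ 2 ≤ ∑ n ∈ s, K * ‖R n β‖ ^ 2 * ‖p‖ ^ 2 := by
          gcongr with n
          refine (pow_le_pow_left₀ (norm_nonneg _) (norm_inner_le_norm _ _) 2).trans ?_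
          rw [mul_pow]
          gcongr
          exact hν.norm_reducedResolvent_sq_le n _
      _ = K * (∑ n ∈ s, ‖R n β‖ ^ 2) * ‖p‖ ^ 2 := by rw [Finset.mul_sum, Finset.sum_mul]
      _ ≤ K * (K * ‖β‖ ^ 2) * ‖p‖ ^ 2 := by
          have := hν.nonneg
          gcongr
          exact hν.sum_norm_reducedResolvent_sq_le β s
      _ = _ := by ring
  have hpointwise : ∀ n, ‖corrector hν β n p q‖ ^ 2 ≤
      2 * ‖⟪R n β, q⟫_ℂ‖ ^ 2 + 2 * ‖⟪R n (R n β), p⟫_ℂ‖ ^ 2 := fun n => by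
    have := norm_sq_le_two_mul_add (corrector hν β n p q) (-Complex.I * ⟪R n β, q⟫_ℂ)
    rwa [corrector, add_sub_cancel_left, norm_mul, norm_neg, Complex.norm_I, one_mul] at this
  have hfirst := hν.sum_norm_inner_reducedResolvent_sq_le β q s
  calc ∑ n ∈ s, ‖corrector hν β n p q‖ ^ 2
      ≤ 2 * ∑ n ∈ s, ‖⟪R n β, q⟫_ℂ‖ ^ 2 + 2 * ∑ n ∈ s, ‖⟪R n (R n β), p⟫_ℂ‖ ^ 2 := by
        rw [Finset.mul_sum, Finset.mul_sum, ← Finset.sum_add_distrib]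
        exact Finset.sum_le_sum fun n _ => hpointwise n
    _ ≤ _ := by linarith

namespace ModalSystem

variable {β : ℓ²(ι, ℂ)} {a b : ℝ} {p q : ℝ → ℓ²(ι, ℂ)} (h : ModalSystem ν β a b p q)

include h

theorem continuousOn_corrector (n : ι) :
    ContinuousOn (fun t => corrector hν β n (p t) (q t)) (Set.Icc a b) :=
  (continuousOn_const.mul (continuousOn_const.inner h.q_forced.cont)).add
    (continuousOn_const.inner h.p_forced.cont)

theorem hasDerivAt_corrector (n : ι) {t : ℝ} (ht : t ∈ Set.Ioo a b) :
    HasDerivAt (fun t => corrector hν β n (p t) (q t))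
      (Complex.I * ν n * corrector hν β n (p t) (q t)
        + (((1 + ‖hν.reducedResolvent n β‖ ^ 2 : ℝ) : ℂ) * ⟪β, q t⟫_ℂ - conj (β n) * q t n)) t := by
  have hq := h.q_forced.hasDerivAt_inner_reducedResolvent hν n β ht
  have hp := h.p_forced.hasDerivAt_inner_reducedResolvent hν n (hν.reducedResolvent n β) ht
  convert! (hq.const_mul (-Complex.I)).add hp using 1
  rw [inner_smul_right, hν.inner_reducedResolvent_left n (hν.reducedResolvent n β) β,
    inner_self_eq_norm_sq_to_K, hν.reducedResolvent_apply_self]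
  unfold corrector
  push_cast
  rw [map_zero]
  linear_combination (⟪β, q t⟫_ℂ - conj (β n) * q t n) * Complex.I_sq

end ModalSystem

end Corrector

section ModeEnergy

variable {γ : ℝ}

theorem abs_re_mul_conj_le (y z : ℂ) : |(y * conj z).re| ≤ ‖y‖ * ‖z‖ := by
  simpa only [norm_mul, RCLike.norm_conj] using Complex.abs_re_le_norm (y * conj z)

/-- The Lyapunov function of a single mode. The first two terms are conserved by a mode without
remainder; the cross term makes the derivative control `‖q‖²`. -/
noncomputable def modeEnergy (γ : ℝ) (σ q z : ℂ) : ℝ :=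
  γ * ‖q‖ ^ 2 - ‖z‖ ^ 2 + (σ * (q * conj z)).re

theorem abs_re_cross_le {σ : ℂ} (hσ : ‖σ‖ ≤ 1) (q z : ℂ) :
    2 * |(σ * (q * conj z)).re| ≤ ‖q‖ ^ 2 + ‖z‖ ^ 2 := by
  have h : |(σ * (q * conj z)).re| ≤ 1 * (‖q‖ * ‖z‖) := by
    refine (Complex.abs_re_le_norm _).trans ?_
    rw [norm_mul, norm_mul, RCLike.norm_conj]
    gcongr
  linarith [two_mul_le_add_sq ‖q‖ ‖z‖]

theorem norm_sq_le_modeEnergy (hγ : 1 ≤ γ) {σ : ℂ} (hσ : ‖σ‖ ≤ 1) (q z : ℂ) :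
    ‖q‖ ^ 2 ≤ 2 * modeEnergy γ σ q z + 3 * ‖z‖ ^ 2 := by
  have hq : ‖q‖ ^ 2 ≤ γ * ‖q‖ ^ 2 := le_mul_of_one_le_left (sq_nonneg _) hγ
  unfold modeEnergy
  linarith [abs_re_cross_le hσ q z, neg_abs_le (σ * (q * conj z)).re]

theorem modeEnergy_le {σ : ℂ} (hσ : ‖σ‖ ≤ 1) (q z : ℂ) :
    2 * modeEnergy γ σ q z ≤ (2 * γ + 1) * ‖q‖ ^ 2 := by
  unfold modeEnergy
  linarith [abs_re_cross_le hσ q z, le_abs_self (σ * (q * conj z)).re, sq_nonneg ‖z‖]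

theorem hasDerivAt_modeEnergy {ν t : ℝ} {β σ : ℂ} (hσ : σ * β = ‖β‖) {P q G z : ℝ → ℂ}
    (hz : z t = γ * P t - G t) (hq' : HasDerivAt q (Complex.I * ν * q t + β * P t) t)
    (hz' : HasDerivAt z (Complex.I * ν * z t + conj β * q t) t) :
    HasDerivAt (fun t => modeEnergy γ σ (q t) (z t))
      (2 * (β * (G t * conj (q t))).re + ‖β‖ * (‖q t‖ ^ 2 + (P t * conj (z t)).re)) t := by
  have hd := Complex.reCLM.hasFDerivAt.comp_hasDerivAt t
    ((((hq'.mul hq'.star).const_mul (γ : ℂ)).sub (hz'.mul hz'.star)).add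
      ((hq'.mul hz'.star).const_mul σ))
  have hcross : ∀ w : ℂ, ‖β‖ * w.re = (σ * β * w).re := fun w => by
    rw [hσ, Complex.re_ofReal_mul]
  convert! hd using 1
  · funext s
    simp [modeEnergy, mul_conj_self_eq, -Complex.ofReal_pow]
  · have hG : G t = γ * P t - z t := by rw [hz]; ring
    rw [hG, ← Complex.ofReal_re (‖q t‖ ^ 2), ← mul_conj_self_eq, ← Complex.add_re,
      hcross]
    simp
    ring

/-- Near-conservation: `γ Re(P z̄) = ‖z‖² + Re(G z̄)` is bounded below by `-‖G‖²`. -/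
theorem neg_le_deriv_modeEnergy (hγ : 1 ≤ γ) (β q P G : ℂ) :
    -(3 / 2 * ‖β‖ * ‖G‖ ^ 2) ≤ 2 * (β * (G * conj q)).re
      + ‖β‖ * (‖q‖ ^ 2 + (P * conj (γ * P - G)).re) := by
  set z := γ * P - G with hz
  have hcoupling : -(‖β‖ * (‖q‖ ^ 2 + ‖G‖ ^ 2)) ≤ 2 * (β * (G * conj q)).re := by
    have h : |(β * (G * conj q)).re| ≤ ‖β‖ * (‖G‖ * ‖q‖) := by
      simpa only [norm_mul, RCLike.norm_conj] using Complex.abs_re_le_norm (β * (G * conj q))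
    have h2 : ‖β‖ * (2 * ‖q‖ * ‖G‖) ≤ ‖β‖ * (‖q‖ ^ 2 + ‖G‖ ^ 2) := by
      gcongr
      exact two_mul_le_add_sq _ _
    linarith [neg_abs_le (β * (G * conj q)).re]
  have hscaled : γ * (P * conj z).re = ‖z‖ ^ 2 + (G * conj z).re := by
    have hP : γ * P = z + G := by rw [hz]; ring
    rw [← Complex.re_ofReal_mul, ← mul_assoc, hP, add_mul, mul_conj_self_eq, Complex.add_re,
      Complex.ofReal_re]
  have hcross : -(1 / 2 * ‖G‖ ^ 2) ≤ (P * conj z).re := by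
    have := (abs_le.1 (abs_re_mul_conj_le G z)).1
    by_contra! hneg
    nlinarith [sq_nonneg (‖z‖ - ‖G‖ / 2), sq_nonneg ‖G‖]
  have := mul_le_mul_of_nonneg_left hcross (norm_nonneg β)
  linarith

theorem norm_sq_left_le_of_normalForm {a b ν : ℝ} (hab : a ≤ b) (hγ : 1 ≤ γ) {β : ℂ}
    {P q G v : ℝ → ℂ} (hP : ContinuousOn P (Set.Icc a b)) (hq : ContinuousOn q (Set.Icc a b))
    (hG : ContinuousOn G (Set.Icc a b))
    (hP' : ∀ t ∈ Set.Ioo a b, HasDerivAt P (Complex.I * ν * P t + v t) t)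
    (hq' : ∀ t ∈ Set.Ioo a b, HasDerivAt q (Complex.I * ν * q t + β * P t) t)
    (hG' : ∀ t ∈ Set.Ioo a b,
      HasDerivAt G (Complex.I * ν * G t + (γ * v t - conj β * q t)) t) :
    ‖q a‖ ^ 2 ≤ 3 * ‖γ * P a - G a‖ ^ 2 + (2 * γ + 1) * ‖q b‖ ^ 2
      + 3 * ‖β‖ * ∫ t in a..b, ‖G t‖ ^ 2 := by
  obtain ⟨σ, hσ1, hσ⟩ := Complex.exists_norm_eq_mul_self β
  set z : ℝ → ℂ := fun t => γ * P t - G t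
  have hz : ContinuousOn z (Set.Icc a b) := (continuousOn_const.mul hP).sub hG
  have hz' : ∀ t ∈ Set.Ioo a b, HasDerivAt z (Complex.I * ν * z t + conj β * q t) t := by
    intro t ht
    convert! ((hP' t ht).const_mul (γ : ℂ)).sub (hG' t ht) using 1
    simp only [z]; ring
  have hcont : ContinuousOn (fun t => -modeEnergy γ σ (q t) (z t)) (Set.Icc a b) :=
    (((continuousOn_const.mul (hq.norm.pow 2)).sub (hz.norm.pow 2)).add
      (Complex.continuous_re.comp_continuousOn (continuousOn_const.mul
        (hq.mul (Complex.continuous_conj.comp_continuousOn hz))))).neg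
  have hdecay := intervalIntegral.sub_le_integral_of_hasDeriv_right_of_le hab hcont
    (fun t ht => (hasDerivAt_modeEnergy hσ.symm rfl (hq' t ht) (hz' t ht)).neg.hasDerivWithinAt)
    (φ := fun t => 3 / 2 * ‖β‖ * ‖G t‖ ^ 2)
    (continuousOn_const.mul (hG.norm.pow 2)).integrableOn_Icc
    fun t _ => neg_le.1 (neg_le_deriv_modeEnergy hγ β (q t) (P t) (G t))
  rw [intervalIntegral.integral_const_mul] at hdecay
  have hstart := norm_sq_le_modeEnergy hγ hσ1.le (q a) (z a)
  have hend := modeEnergy_le (γ := γ) hσ1.le (q b) (z b)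
  linarith

end ModeEnergy

theorem exists_nat_mul_eq {x L : ℝ} (hL : 0 < L) (hLx : L ≤ x) :
    ∃ (M : ℕ) (l : ℝ), M * l = x ∧ L ≤ l ∧ l ≤ 2 * L := by
  have hx : 0 ≤ x / L := div_nonneg (hL.le.trans hLx) hL.le
  have hM : (1 : ℝ) ≤ ⌊x / L⌋₊ := by
    exact_mod_cast (Nat.one_le_floor_iff _).2 ((one_le_div hL).2 hLx)
  have hMpos : (0 : ℝ) < ⌊x / L⌋₊ := by linarith
  have hle : ⌊x / L⌋₊ * L ≤ x := (le_div_iff₀ hL).1 (Nat.floor_le hx)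
  have hlt : x < (⌊x / L⌋₊ + 1) * L := (div_lt_iff₀ hL).1 (Nat.lt_floor_add_one _)
  refine ⟨⌊x / L⌋₊, x / ⌊x / L⌋₊, mul_div_cancel₀ _ hMpos.ne', ?_, ?_⟩
  · rwa [le_div_iff₀ hMpos, mul_comm]
  · rw [div_le_iff₀ hMpos]
    nlinarith

theorem integral_le_of_blocks {a b L C : ℝ} (hL : 0 < L) (hLab : L ≤ b - a) {g e : ℝ → ℝ}
    (hg : ContinuousOn g (Set.Icc a b)) (he : ContinuousOn e (Set.Icc a b))
    (hblock : ∀ c d, a ≤ c → d ≤ b → L ≤ d - c → d - c ≤ 2 * L →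
      ∫ t in c..d, g t ≤ C * ∫ t in c..d, e t) :
    ∫ t in a..b, g t ≤ C * ∫ t in a..b, e t := by
  obtain ⟨M, l, hMl, hLl, hl2⟩ := exists_nat_mul_eq hL hLab
  have hl : 0 ≤ l := hL.le.trans hLl
  set node : ℕ → ℝ := fun j => a + j * l
  have hlength : ∀ j, node (j + 1) - node j = l := fun j => by simp only [node]; push_cast; ring
  have hleft : ∀ j, a ≤ node j := fun j => le_add_of_nonneg_right (by positivity)
  have hright : ∀ j < M, node (j + 1) ≤ b := fun j hj => by
    have : ((j + 1 : ℕ) : ℝ) * l ≤ M * l := by gcongr; exact hj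
    simp only [node]
    linarith
  have hsum : ∀ f : ℝ → ℝ, ContinuousOn f (Set.Icc a b) →
      ∑ j ∈ Finset.range M, ∫ t in node j..node (j + 1), f t = ∫ t in a..b, f t := fun f hf => by
    have hfirst : node 0 = a := by simp [node]
    have hlast : node M = b := by simp [node, hMl]
    rw [intervalIntegral.sum_integral_adjacent_intervals fun j hj =>
      (hf.mono (Set.Icc_subset_Icc (hleft j) (hright j hj))).intervalIntegrable_of_Icc
        (by linarith [hlength j]), hfirst, hlast]
  rw [← hsum g hg, ← hsum e he, Finset.mul_sum]
  refine Finset.sum_le_sum fun j hj => hblock _ _ (hleft j) (hright j (Finset.mem_range.1 hj)) ?_ ?_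
  all_goals rwa [hlength]

namespace ModalSystem

variable {ι : Type*} {ν : ι → ℝ} {K : ℝ} {β : ℓ²(ι, ℂ)} {a b L : ℝ} {p q : ℝ → ℓ²(ι, ℂ)}

theorem energy_nonneg (β : ℓ²(ι, ℂ)) (hab : a ≤ b) (p q : ℝ → ℓ²(ι, ℂ)) :
    0 ≤ modalEnergy β a b p q :=
  intervalIntegral.integral_nonneg hab fun _ _ => by positivity

variable (h : ModalSystem ν β a b p q)

include h

theorem norm_p_right_sq_le (hab : a ≤ b) (hL : 1 ≤ L) :
    ‖p b‖ ^ 2 ≤ 2 * ‖p a‖ ^ 2 + 2 * (1 + ‖β‖ ^ 2 * L) * modalEnergy β a b p q := by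
  have hE := energy_nonneg β hab p q
  rcases le_total (b - a) L with hshort | hlong
  · have hduhamel := h.p_forced.norm_sq_le (Set.right_mem_Icc.2 hab) (Set.left_mem_Icc.2 hab)
    have hforcing := mul_le_mul hshort (h.integral_norm_forcing_sq_le_energy hab)
      (intervalIntegral.integral_nonneg hab fun _ _ => sq_nonneg _) (by linarith)
    linarith
  · have hsub : a ≤ b - L := by linarith
    have hL' : b - L ≤ b := by linarith
    have hE' := h.energy_mono hsub hL' le_rfl
    have hmean := (h.p_forced.mono hsub le_rfl).mul_norm_sq_le (Set.right_mem_Icc.2 hL')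
    have hp := ((h.mono hsub le_rfl).integral_norm_sq_le_energy hL').trans hE'
    have hforcing := ((h.mono hsub le_rfl).integral_norm_forcing_sq_le_energy hL').trans
      (mul_le_mul_of_nonneg_left hE' (sq_nonneg _))
    rw [sub_sub_cancel] at hmean
    have hscaled : L * ‖p b‖ ^ 2 ≤ L * (2 * (1 + ‖β‖ ^ 2 * L) * modalEnergy β a b p q) :=
      calc L * ‖p b‖ ^ 2 ≤ 2 * modalEnergy β a b p q
            + 2 * (L ^ 2 * (‖β‖ ^ 2 * modalEnergy β a b p q)) := hmean.trans (by gcongr)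
        _ ≤ 2 * (L * modalEnergy β a b p q)
            + 2 * (L ^ 2 * (‖β‖ ^ 2 * modalEnergy β a b p q)) := by
            gcongr
            exact le_mul_of_one_le_left hE hL
        _ = _ := by ring
    linarith [le_of_mul_le_mul_left hscaled (by linarith), sq_nonneg ‖p a‖]

theorem norm_coupling_q_left_sq_le (hν : SquareSeparated ν K) (hab : a ≤ b) (hL : 1 ≤ L)
    (hKL : 120 * K ≤ L ^ 2) :
    ‖coupling β (q a)‖ ^ 2 ≤
      2 * (‖β‖ ^ 2 * ‖q b‖ ^ 2) + (16 + 18 * (‖β‖ ^ 2 * L)) * modalEnergy β a b p q := by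
  have hE := energy_nonneg β hab p q
  rcases le_total (b - a) L with hshort | hlong
  · have hduhamel := h.q_forced.norm_sq_le (Set.left_mem_Icc.2 hab) (Set.right_mem_Icc.2 hab)
    have hp := mul_le_mul hshort (h.integral_norm_sq_le_energy hab)
      (intervalIntegral.integral_nonneg hab fun _ _ => sq_nonneg _) (by linarith)
    calc ‖coupling β (q a)‖ ^ 2 ≤ ‖β‖ ^ 2 * ‖q a‖ ^ 2 := norm_coupling_sq_le β (q a)
      _ ≤ ‖β‖ ^ 2 * (2 * ‖q b‖ ^ 2 + 2 * (L * modalEnergy β a b p q)) := by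
          gcongr
          linarith
      _ ≤ _ := by nlinarith [mul_nonneg (mul_nonneg (sq_nonneg ‖β‖) (by linarith : 0 ≤ L)) hE]
  · have hsub : a + L ≤ b := by linarith
    have hL' : a < a + L := by linarith
    have hobs := (h.mono le_rfl hsub).norm_coupling_sq_le_energy hν hL'
      (by rwa [add_sub_cancel_left]) (Set.left_mem_Icc.2 hL'.le)
    rw [add_sub_cancel_left] at hobs
    calc ‖coupling β (q a)‖ ^ 2 ≤ _ := hobs
      _ ≤ (16 + 18 * (‖β‖ ^ 2 * L)) * modalEnergy β a b p q := by
          gcongr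
          · exact energy_nonneg β hL'.le p q
          · exact div_le_self (by norm_num) hL
          · exact h.energy_mono le_rfl hL'.le hsub
      _ ≤ _ := le_add_of_nonneg_left (by positivity)

theorem energy_le_of_boundary (hab : a ≤ b) {r : ℓ²(ι, ℂ)} (hr : p a = coupling β r) {C : ℝ}
    (hC : 0 < C)
    (hpb : ‖p b‖ ^ 2 ≤ C * (‖r‖ ^ 2 + ‖q b‖ ^ 2 + modalEnergy β a b p q))
    (hqa : ‖coupling β (q a)‖ ^ 2 ≤ C * (‖r‖ ^ 2 + ‖q b‖ ^ 2 + modalEnergy β a b p q)) :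
    modalEnergy β a b p q ≤ (1 + 2 * C) * (‖r‖ ^ 2 + ‖q b‖ ^ 2) := by
  set E := modalEnergy β a b p q
  set D := ‖r‖ ^ 2 + ‖q b‖ ^ 2
  have hyoung : ∀ {x : ℝ} (y : ℝ), x ^ 2 ≤ C * (D + E) → x * y ≤ (D + E) / 4 + C * y ^ 2 := by
    intro x y hx
    have : C * (x * y) ≤ C * ((D + E) / 4 + C * y ^ 2) := by
      nlinarith [sq_nonneg (x - 2 * (C * y))]
    exact le_of_mul_le_mul_left this hC
  have hright : (⟪p b, q b⟫_ℂ).re ≤ ‖p b‖ * ‖q b‖ :=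
    (Complex.re_le_norm _).trans (norm_inner_le_norm _ _)
  have hleft : -(⟪p a, q a⟫_ℂ).re ≤ ‖coupling β (q a)‖ * ‖r‖ := by
    rw [hr, mul_comm]
    exact ((neg_le_abs _).trans (Complex.abs_re_le_norm _)).trans (norm_inner_coupling_le _ _ _)
  have hE : E = (⟪p b, q b⟫_ℂ).re - (⟪p a, q a⟫_ℂ).re := h.energy_eq hab
  have := hyoung ‖q b‖ hpb
  have := hyoung ‖r‖ hqa
  simp only [D] at *
  linarith

end ModalSystem

namespace ModalSystem

variable {ι : Type*} {ν : ι → ℝ} {K : ℝ} {β : ℓ²(ι, ℂ)} {a b L : ℝ} {p q : ℝ → ℓ²(ι, ℂ)}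

theorem norm_coupling_sq_le_of_block (hν : SquareSeparated ν K) (h : ModalSystem ν β a b p q)
    (hL : 1 ≤ L) (hKL : 120 * K ≤ L ^ 2) (hLab : L ≤ b - a) (hab2 : b - a ≤ 2 * L)
    {t : ℝ} (ht : t ∈ Set.Icc a b) :
    ‖coupling β (q t)‖ ^ 2 ≤ (16 + 36 * (‖β‖ ^ 2 * L)) * modalEnergy β a b p q := by
  have hab : a < b := by linarith
  refine (h.norm_coupling_sq_le_energy hν hab (hKL.trans (by gcongr)) ht).trans ?_
  have : 16 / (b - a) ≤ 16 := div_le_self (by norm_num) (hL.trans hLab)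
  have : ‖β‖ ^ 2 * (b - a) ≤ ‖β‖ ^ 2 * (2 * L) := by gcongr
  exact mul_le_mul_of_nonneg_right (by linarith) (energy_nonneg β hab.le p q)

theorem integral_corrector_le (hν : SquareSeparated ν K) (h : ModalSystem ν β a b p q)
    (hL : 1 ≤ L) (hKL : 120 * K ≤ L ^ 2) (hLab : L ≤ b - a) (s : Finset ι) :
    ∫ t in a..b, ∑ n ∈ s, ‖corrector hν β n (p t) (q t)‖ ^ 2 ≤
      (2 * L * (8 * (5 + 28 * K) ^ 2 * (16 + 36 * (‖β‖ ^ 2 * L))) + 2 * (K ^ 2 * ‖β‖ ^ 2)) *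
        modalEnergy β a b p q := by
  have hL0 : 0 < L := by linarith
  have hcorr : ContinuousOn (fun t => ∑ n ∈ s, ‖corrector hν β n (p t) (q t)‖ ^ 2) (Set.Icc a b) :=
    continuousOn_finsetSum _ fun n _ => (h.continuousOn_corrector hν n).norm.pow 2
  refine integral_le_of_blocks hL0 hLab hcorr h.continuousOn_energyDensity
    fun c d hc hd hLcd hcd2 => ?_
  have hcd : c < d := by linarith
  have hblock := h.mono hc hd
  have hE := energy_nonneg β hcd.le p q
  have henergy := hblock.integral_norm_sq_le_energy hcd.le
  change _ ≤ _ * modalEnergy β c d p q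
  set E := modalEnergy β c d p q
  have hp : ContinuousOn (fun t => 2 * (K ^ 2 * ‖β‖ ^ 2) * ‖p t‖ ^ 2) (Set.Icc c d) :=
    continuousOn_const.mul (hblock.p_forced.cont.norm.pow 2)
  calc ∫ t in c..d, ∑ n ∈ s, ‖corrector hν β n (p t) (q t)‖ ^ 2
      ≤ ∫ t in c..d, (8 * (5 + 28 * K) ^ 2 * ((16 + 36 * (‖β‖ ^ 2 * L)) * E)
          + 2 * (K ^ 2 * ‖β‖ ^ 2) * ‖p t‖ ^ 2) :=
        intervalIntegral.integral_mono_on hcd.le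
          ((hcorr.mono (Set.Icc_subset_Icc hc hd)).intervalIntegrable_of_Icc hcd.le)
          ((continuousOn_const.add hp).intervalIntegrable_of_Icc hcd.le) fun t ht =>
            (sum_norm_corrector_sq_le hν β (p t) (q t) s).trans (by 
              gcongr
              exact hblock.norm_coupling_sq_le_of_block hν hL hKL hLcd hcd2 ht)
    _ = (d - c) * (8 * (5 + 28 * K) ^ 2 * ((16 + 36 * (‖β‖ ^ 2 * L)) * E))
          + 2 * (K ^ 2 * ‖β‖ ^ 2) * ∫ t in c..d, ‖p t‖ ^ 2 := by
        rw [intervalIntegral.integral_add (by simp) (hp.intervalIntegrable_of_Icc hcd.le),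
          intervalIntegral.integral_const, smul_eq_mul, intervalIntegral.integral_const_mul]
    _ ≤ 2 * L * (8 * (5 + 28 * K) ^ 2 * ((16 + 36 * (‖β‖ ^ 2 * L)) * E))
          + 2 * (K ^ 2 * ‖β‖ ^ 2) * E := by gcongr
    _ = _ := by ring

variable (hν : SquareSeparated ν K) (h : ModalSystem ν β a b p q)

include hν h

theorem norm_sq_apply_left_le (hab : a ≤ b) {n : ι} (hβ : β n ≠ 0) :
    ‖q a n‖ ^ 2 ≤
      3 * ‖((1 + ‖hν.reducedResolvent n β‖ ^ 2 : ℝ) : ℂ) * (p a n / β n)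
        - corrector hν β n (p a) (q a)‖ ^ 2
      + (2 * (1 + ‖hν.reducedResolvent n β‖ ^ 2) + 1) * ‖q b n‖ ^ 2
      + 3 * ‖β n‖ * ∫ t in a..b, ‖corrector hν β n (p t) (q t)‖ ^ 2 := by
  have hcont := fun x (hx : ContinuousOn x (Set.Icc a b)) =>
    (lp.evalCLM ℂ (fun _ : ι => ℂ) 2 n).continuous.comp_continuousOn hx
  refine norm_sq_left_le_of_normalForm (P := fun t => p t n / β n) (q := fun t => q t n)
    (G := fun t => corrector hν β n (p t) (q t)) (v := fun t => ⟪β, q t⟫_ℂ) hab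
    (le_add_of_nonneg_right (sq_nonneg _)) ((hcont p h.p_forced.cont).div_const _)
    (hcont q h.q_forced.cont) (h.continuousOn_corrector hν n) (fun t ht => ?_) (fun t ht => ?_)
    fun t ht => h.hasDerivAt_corrector hν n ht
  · convert! (h.p_forced.hasDerivAt n t ht).div_const (β n) using 1
    rw [lp.coeFn_smul, Pi.smul_apply, smul_eq_mul]
    field_simp
  · convert! h.q_forced.hasDerivAt n t ht using 1
    field_simp

theorem norm_sq_apply_left_le_of_eq_coupling (hab : a ≤ b) {n : ι} (hβ : β n ≠ 0)
    {r : ℓ²(ι, ℂ)} (hr : p a = coupling β r) :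
    ‖q a n‖ ^ 2 ≤ 6 * (1 + K * ‖β‖ ^ 2) ^ 2 * ‖r n‖ ^ 2 + (2 * (1 + K * ‖β‖ ^ 2) + 1) * ‖q b n‖ ^ 2
      + 6 * ‖corrector hν β n (p a) (q a)‖ ^ 2
      + 3 * ‖β‖ * ∫ t in a..b, ‖corrector hν β n (p t) (q t)‖ ^ 2 := by
  have hmode := h.norm_sq_apply_left_le hν hab hβ
  have hr' : p a n / β n = r n := by rw [hr, coupling_apply, mul_div_cancel_left₀ _ hβ]
  rw [hr'] at hmode
  set γ := 1 + ‖hν.reducedResolvent n β‖ ^ 2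
  set G := fun t => corrector hν β n (p t) (q t)
  have hγ : γ ≤ 1 + K * ‖β‖ ^ 2 := by
    have := hν.norm_reducedResolvent_sq_le n β
    simp only [γ]
    linarith
  have hstart : ‖γ * r n - G a‖ ^ 2 ≤ 2 * ((1 + K * ‖β‖ ^ 2) ^ 2 * ‖r n‖ ^ 2) + 2 * ‖G a‖ ^ 2 := by
    have hsplit := norm_sq_le_two_mul_add (γ * r n - G a) (γ * r n)
    have hweight : ‖γ * r n‖ ^ 2 ≤ (1 + K * ‖β‖ ^ 2) ^ 2 * ‖r n‖ ^ 2 := by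
      rw [norm_mul, mul_pow, Complex.norm_real, Real.norm_eq_abs, sq_abs]
      gcongr
    rw [sub_sub_cancel_left, norm_neg] at hsplit
    linarith
  have : 0 ≤ ∫ t in a..b, ‖G t‖ ^ 2 := intervalIntegral.integral_nonneg hab fun _ _ => sq_nonneg _
  have hβn : ‖β n‖ ≤ ‖β‖ := lp.norm_apply_le_norm two_ne_zero β n
  calc ‖q a n‖ ^ 2 ≤ _ := hmode
    _ ≤ 3 * (2 * ((1 + K * ‖β‖ ^ 2) ^ 2 * ‖r n‖ ^ 2) + 2 * ‖G a‖ ^ 2)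
      + (2 * (1 + K * ‖β‖ ^ 2) + 1) * ‖q b n‖ ^ 2 + 3 * ‖β‖ * ∫ t in a..b, ‖G t‖ ^ 2 := by gcongr
    _ = _ := by ring

theorem sum_norm_sq_left_le (hab : a ≤ b) (hβ : ∀ n, β n ≠ 0) {r : ℓ²(ι, ℂ)}
    (hr : p a = coupling β r) (s : Finset ι) :
    ∑ n ∈ s, ‖q a n‖ ^ 2 ≤
      6 * (1 + K * ‖β‖ ^ 2) ^ 2 * ‖r‖ ^ 2 + (2 * (1 + K * ‖β‖ ^ 2) + 1) * ‖q b‖ ^ 2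
        + 6 * ∑ n ∈ s, ‖corrector hν β n (p a) (q a)‖ ^ 2
        + 3 * ‖β‖ * ∫ t in a..b, ∑ n ∈ s, ‖corrector hν β n (p t) (q t)‖ ^ 2 := by
  have hK := hν.nonneg
  have hint : ∀ n ∈ s,
      IntervalIntegrable (fun t => ‖corrector hν β n (p t) (q t)‖ ^ 2) volume a b := fun n _ =>
    ((h.continuousOn_corrector hν n).norm.pow 2).intervalIntegrable_of_Icc hab
  rw [intervalIntegral.integral_finsetSum hint]
  refine (Finset.sum_le_sum fun n _ =>
    h.norm_sq_apply_left_le_of_eq_coupling hν hab (hβ n) hr).trans ?_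
  simp only [Finset.sum_add_distrib, ← Finset.mul_sum]
  gcongr
  · exact sum_norm_sq_le r s
  · exact sum_norm_sq_le (q b) s

theorem norm_q_left_sq_le_of_long (hβ : ∀ n, β n ≠ 0) {r : ℓ²(ι, ℂ)} (hr : p a = coupling β r)
    (hL : 1 ≤ L) (hKL : 120 * K ≤ L ^ 2) (hLab : L ≤ b - a) :
    ‖q a‖ ^ 2 ≤
      6 * (1 + K * ‖β‖ ^ 2) ^ 2 * ‖r‖ ^ 2 + (2 * (1 + K * ‖β‖ ^ 2) + 1) * ‖q b‖ ^ 2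
        + 6 * (8 * (5 + 28 * K) ^ 2 * ‖coupling β (q a)‖ ^ 2 + 2 * (K ^ 2 * ‖β‖ ^ 2) * ‖p a‖ ^ 2)
        + 3 * ‖β‖ * ((2 * L * (8 * (5 + 28 * K) ^ 2 * (16 + 36 * (‖β‖ ^ 2 * L)))
          + 2 * (K ^ 2 * ‖β‖ ^ 2)) * modalEnergy β a b p q) := by
  refine norm_sq_le_of_forall_sum_le fun s => ?_
  refine (h.sum_norm_sq_left_le hν (by linarith) hβ hr s).trans ?_
  gcongr
  · exact sum_norm_corrector_sq_le hν β (p a) (q a) s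
  · exact h.integral_corrector_le hν hL hKL hLab s

omit hν in
theorem norm_q_left_sq_le_of_short (hab : a ≤ b) (hLab : b - a ≤ L) :
    ‖q a‖ ^ 2 ≤ 2 * ‖q b‖ ^ 2 + 2 * (L * modalEnergy β a b p q) := by
  refine (h.q_forced.norm_sq_le (Set.left_mem_Icc.2 hab) (Set.right_mem_Icc.2 hab)).trans ?_
  gcongr
  · exact intervalIntegral.integral_nonneg hab fun _ _ => sq_nonneg _
  · linarith
  · exact h.integral_norm_sq_le_energy hab

end ModalSystem

namespace SquareSeparated

variable {ι : Type*} {ν : ι → ℝ} {K : ℝ} (hν : SquareSeparated ν K) (β : ℓ²(ι, ℂ))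

include hν

theorem exists_block_length : ∃ L : ℝ, 1 ≤ L ∧ 120 * K ≤ L ^ 2 := by
  have := hν.nonneg
  exact ⟨1 + 120 * K, by linarith, by nlinarith⟩

theorem exists_energy_bound : ∃ C, 0 ≤ C ∧ ∀ {a b : ℝ} {p q : ℝ → ℓ²(ι, ℂ)} {r : ℓ²(ι, ℂ)},
    a ≤ b → ModalSystem ν β a b p q → p a = coupling β r →
    modalEnergy β a b p q ≤ C * (‖r‖ ^ 2 + ‖q b‖ ^ 2) ∧ ‖p b‖ ^ 2 ≤ C * (‖r‖ ^ 2 + ‖q b‖ ^ 2) ∧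
      ‖coupling β (q a)‖ ^ 2 ≤ C * (‖r‖ ^ 2 + ‖q b‖ ^ 2) := by
  obtain ⟨L, hL, hKL⟩ := hν.exists_block_length
  set c := ‖β‖ ^ 2 * L
  have hβc : ‖β‖ ^ 2 ≤ c := le_mul_of_one_le_right (sq_nonneg _) hL
  have : 0 ≤ c := (sq_nonneg _).trans hβc
  refine ⟨2 * (16 + 18 * c) * (1 + (16 + 18 * c)), by positivity, fun {a b p q r} hab h hr => ?_⟩
  have hE := ModalSystem.energy_nonneg β hab p q
  have hpa := norm_coupling_sq_le β r
  rw [← hr] at hpa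
  have hpb : ‖p b‖ ^ 2 ≤ (16 + 18 * c) * (‖r‖ ^ 2 + ‖q b‖ ^ 2 + modalEnergy β a b p q) := by
    have := h.norm_p_right_sq_le hab hL
    nlinarith [sq_nonneg ‖r‖, sq_nonneg ‖q b‖]
  have hqa : ‖coupling β (q a)‖ ^ 2 ≤
      (16 + 18 * c) * (‖r‖ ^ 2 + ‖q b‖ ^ 2 + modalEnergy β a b p q) := by
    have := h.norm_coupling_q_left_sq_le hν hab hL hKL
    nlinarith [sq_nonneg ‖r‖, sq_nonneg ‖q b‖]
  have henergy := h.energy_le_of_boundary hab hr (by positivity) hpb hqa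
  have hbound : (16 + 18 * c) * (‖r‖ ^ 2 + ‖q b‖ ^ 2 + modalEnergy β a b p q) ≤
      2 * (16 + 18 * c) * (1 + (16 + 18 * c)) * (‖r‖ ^ 2 + ‖q b‖ ^ 2) := by
    have := mul_le_mul_of_nonneg_left henergy (by positivity : 0 ≤ 16 + 18 * c)
    linarith
  refine ⟨henergy.trans ?_, hpb.trans hbound, hqa.trans hbound⟩
  gcongr
  nlinarith

theorem exists_boundary_bound (hβ : ∀ n, β n ≠ 0) : ∃ C, 0 ≤ C ∧
    ∀ {a b : ℝ} {p q : ℝ → ℓ²(ι, ℂ)} {r : ℓ²(ι, ℂ)}, a ≤ b → ModalSystem ν β a b p q →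
      p a = coupling β r → ‖q a‖ ^ 2 + ‖p b‖ ^ 2 ≤ C * (‖r‖ ^ 2 + ‖q b‖ ^ 2) := by
  have hK := hν.nonneg
  obtain ⟨L, hL, hKL⟩ := hν.exists_block_length
  obtain ⟨C, hC, hbound⟩ := hν.exists_energy_bound β
  set Γ := 1 + K * ‖β‖ ^ 2
  set short := 2 + 2 * (L * C)
  set long := 6 * Γ ^ 2 + (2 * Γ + 1)
    + 6 * (8 * (5 + 28 * K) ^ 2 * C + 2 * (K ^ 2 * ‖β‖ ^ 2) * ‖β‖ ^ 2)
    + 3 * ‖β‖ * ((2 * L * (8 * (5 + 28 * K) ^ 2 * (16 + 36 * (‖β‖ ^ 2 * L)))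
      + 2 * (K ^ 2 * ‖β‖ ^ 2)) * C)
  have : 0 ≤ short := by positivity
  have : 0 ≤ long := by positivity
  refine ⟨short + long + C, by positivity, fun {a b p q r} hab h hr => ?_⟩
  obtain ⟨hE, hpb, hcoupling⟩ := hbound hab h hr
  have hpa := norm_coupling_sq_le β r
  rw [← hr] at hpa
  set D := ‖r‖ ^ 2 + ‖q b‖ ^ 2
  have hr_le : ‖r‖ ^ 2 ≤ D := le_add_of_nonneg_right (sq_nonneg _)
  have hq_le : ‖q b‖ ^ 2 ≤ D := le_add_of_nonneg_left (sq_nonneg _)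
  have : 0 ≤ D := (sq_nonneg _).trans hr_le
  have hqa : ‖q a‖ ^ 2 ≤ short * D + long * D := by
    rcases le_total (b - a) L with hab' | hab'
    · refine le_add_of_le_of_nonneg ((h.norm_q_left_sq_le_of_short hab hab').trans ?_)
        (by positivity)
      calc _ ≤ 2 * D + 2 * (L * (C * D)) := by gcongr
        _ = short * D := by ring
    · refine le_add_of_nonneg_of_le (by positivity)
        ((h.norm_q_left_sq_le_of_long hν hβ hr hL hKL hab').trans ?_)
      calc _ ≤ 6 * Γ ^ 2 * D + (2 * Γ + 1) * D
            + 6 * (8 * (5 + 28 * K) ^ 2 * (C * D) + 2 * (K ^ 2 * ‖β‖ ^ 2) * (‖β‖ ^ 2 * D))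
            + 3 * ‖β‖ * ((2 * L * (8 * (5 + 28 * K) ^ 2 * (16 + 36 * (‖β‖ ^ 2 * L)))
              + 2 * (K ^ 2 * ‖β‖ ^ 2)) * (C * D)) := by
            gcongr
            exact hpa.trans (by gcongr)
        _ = long * D := by ring
  linarith

end SquareSeparated

section Coordinates

/-- The coordinate `ξ_k` of `(ξ, η) ∈ H`, as a continuous linear functional. -/
noncomputable def fstCoord (k : ℕ) : H →L[ℝ] ℝ :=
  lp.evalCLM ℝ (fun _ : ℕ => ℝ) 2 k ∘L WithLp.fstL 2 ℝ (Ell2 ℝ) (Ell2 ℝ)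

/-- The coordinate `η_k` of `(ξ, η) ∈ H`, as a continuous linear functional. -/
noncomputable def sndCoord (k : ℕ) : H →L[ℝ] ℝ :=
  lp.evalCLM ℝ (fun _ : ℕ => ℝ) 2 k ∘L WithLp.sndL 2 ℝ (Ell2 ℝ) (Ell2 ℝ)

theorem fstCoord_apply (k : ℕ) (y : H) : fstCoord k y = y.fst k := rfl

theorem sndCoord_apply (k : ℕ) (y : H) : sndCoord k y = y.snd k := rfl

theorem fst_smul_vecB (b : Ell2 ℝ) (c : ℝ) (k : ℕ) : (c • vecB b).fst k = 0 := by simp [vecB]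

theorem snd_smul_vecB (b : Ell2 ℝ) (c : ℝ) (k : ℕ) : (c • vecB b).snd k = b k * c := by
  simp [vecB, mul_comm]

theorem hasSum_ell2_sq (x : Ell2 ℝ) : HasSum (fun k => x k ^ 2) (‖x‖ ^ 2) := by
  simpa using lp.hasSum_norm (p := 2) (by norm_num) x

theorem inner_vecB (b : Ell2 ℝ) (y : H) : inner ℝ (vecB b) y = ∑' k, b k * y.snd k := by
  rw [WithLp.prod_inner_apply, lp.inner_eq_tsum, lp.inner_eq_tsum]
  simp [vecB, mul_comm]

end Coordinates

section Solutions

variable {ω : ℕ → ℝ} {T : ℝ} {f g x y : ℝ → H}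

theorem hasDerivAt_of_eq_add_integral {φ ψ : ℝ → ℝ} {c : ℝ} (hψ : ContinuousOn ψ (Set.Icc 0 T))
    (hφ : ∀ t ∈ Set.Icc (0 : ℝ) T, φ t = c + ∫ s in (0 : ℝ)..t, ψ s) {t : ℝ}
    (ht : t ∈ Set.Ioo 0 T) : HasDerivAt φ (ψ t) t := by
  have hprim : HasDerivAt (fun t => c + ∫ s in (0 : ℝ)..t, ψ s) (ψ t) t :=
    (intervalIntegral.integral_hasDerivAt_right
      ((hψ.mono (Set.Icc_subset_Icc_right ht.2.le)).intervalIntegrable_of_Icc ht.1.le)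
      ((hψ.mono Set.Ioo_subset_Icc_self).stronglyMeasurableAtFilter isOpen_Ioo t ht)
      (hψ.continuousAt (Icc_mem_nhds ht.1 ht.2))).const_add c
  refine hprim.congr_of_eventuallyEq ?_
  filter_upwards [Icc_mem_nhds ht.1 ht.2] with s hs using hφ s hs

theorem add_integral_linearCombination {T t c₁ c₂ ε : ℝ} (ht : t ∈ Set.Icc 0 T) {φ ψ : ℝ → ℝ}
    (hφ : IntervalIntegrable φ volume 0 T) (hψ : IntervalIntegrable ψ volume 0 T) :
    (c₁ + ∫ s in (0 : ℝ)..t, φ s) + ε * (c₂ + ∫ s in (0 : ℝ)..t, ψ s) =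
      (c₁ + ε * c₂) + ∫ s in (0 : ℝ)..t, (φ s + ε * ψ s) := by
  have hsub : Set.uIcc 0 t ⊆ Set.uIcc 0 T := by
    rw [Set.uIcc_of_le ht.1, Set.uIcc_of_le (ht.1.trans ht.2)]
    exact Set.Icc_subset_Icc_right ht.2
  rw [intervalIntegral.integral_add (hφ.mono_set hsub) ((hψ.mono_set hsub).const_mul ε),
    intervalIntegral.integral_const_mul]
  ring

theorem intervalIntegrable_clm_comp {E : Type*} [NormedAddCommGroup E] [NormedSpace ℝ E]
    {a b : ℝ} {f : ℝ → E} (hf : IntervalIntegrable f volume a b) (L : E →L[ℝ] ℝ) :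
    IntervalIntegrable (fun t => L (f t)) volume a b :=
  ⟨L.integrable_comp hf.1, L.integrable_comp hf.2⟩

namespace IsSolution

theorem of_hasDerivAt (hf : ContinuousOn f (Set.Icc 0 T)) (hy : ContinuousOn y (Set.Icc 0 T))
    (hfst : ∀ k, ∀ t ∈ Set.Ioo 0 T,
      HasDerivAt (fun t => (y t).fst k) (ω k * (y t).snd k + (f t).fst k) t)
    (hsnd : ∀ k, ∀ t ∈ Set.Ioo 0 T,
      HasDerivAt (fun t => (y t).snd k) (-(ω k * (y t).fst k) + (f t).snd k) t) :
    IsSolution ω T f y := by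
  have hcont (L : H →L[ℝ] ℝ) {z : ℝ → H} (hz : ContinuousOn z (Set.Icc 0 T)) {t : ℝ}
      (ht : t ∈ Set.Icc 0 T) : ContinuousOn (fun t => L (z t)) (Set.Icc 0 t) :=
    L.continuous.comp_continuousOn (hz.mono (Set.Icc_subset_Icc_right ht.2))
  have hIoo {t : ℝ} (ht : t ∈ Set.Icc 0 T) : Set.Ioo 0 t ⊆ Set.Ioo 0 T :=
    Set.Ioo_subset_Ioo_right ht.2
  refine ⟨hy, fun k t ht => ?_, fun k t ht => ?_⟩
  · rw [intervalIntegral.integral_eq_sub_of_hasDerivAt_of_le ht.1 (hcont (fstCoord k) hy ht)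
      (fun s hs => hfst k s (hIoo ht hs)) (ContinuousOn.intervalIntegrable_of_Icc ht.1
        ((continuousOn_const.mul (hcont (sndCoord k) hy ht)).add (hcont (fstCoord k) hf ht)))]
    simp only [fstCoord_apply]; ring
  · rw [intervalIntegral.integral_eq_sub_of_hasDerivAt_of_le ht.1 (hcont (sndCoord k) hy ht)
      (fun s hs => hsnd k s (hIoo ht hs)) (ContinuousOn.intervalIntegrable_of_Icc ht.1
        ((continuousOn_const.mul (hcont (fstCoord k) hy ht)).neg.add (hcont (sndCoord k) hf ht)))]
    simp only [sndCoord_apply]; ring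

theorem const {w w' : H} (hfst : ∀ k, ω k * w.snd k + w'.fst k = 0)
    (hsnd : ∀ k, -(ω k * w.fst k) + w'.snd k = 0) (T : ℝ) :
    IsSolution ω T (fun _ => w') fun _ => w where
  cont := continuousOn_const
  fst_eq k t _ := by simp [hfst]
  snd_eq k t _ := by simp [hsnd]

theorem congr_ae (hx : IsSolution ω T f x) (hfg : ∀ᵐ t, t ∈ Set.Ioo 0 T → f t = g t) :
    IsSolution ω T g x := by
  have heq {t : ℝ} (ht : t ∈ Set.Icc 0 T) : ∀ᵐ s, s ∈ Set.uIoc 0 t → f s = g s := by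
    have hne : ∀ᵐ s : ℝ, s ≠ T := by simp [ae_iff]
    rw [Set.uIoc_of_le ht.1]
    filter_upwards [hfg, hne] with s hs hsT hst
    exact hs ⟨hst.1, (hst.2.trans ht.2).lt_of_ne hsT⟩
  refine ⟨hx.cont, fun k t ht => ?_, fun k t ht => ?_⟩
  · rw [hx.fst_eq k t ht]
    congr 1
    exact intervalIntegral.integral_congr_ae ((heq ht).mono fun s h hs => by rw [h hs])
  · rw [hx.snd_eq k t ht]
    congr 1
    exact intervalIntegral.integral_congr_ae ((heq ht).mono fun s h hs => by rw [h hs])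

variable (hx : IsSolution ω T f x)

include hx

theorem add_smul (hy : IsSolution ω T g y) (hT : 0 ≤ T) (hf : IntervalIntegrable f volume 0 T)
    (hg : IntervalIntegrable g volume 0 T) (ε : ℝ) :
    IsSolution ω T (fun t => f t + ε • g t) fun t => x t + ε • y t := by
  have hint (L L' : H →L[ℝ] ℝ) (c : ℝ) {z w : ℝ → H} (hz : ContinuousOn z (Set.Icc 0 T))
      (hw : IntervalIntegrable w volume 0 T) :
      IntervalIntegrable (fun t => c * L (z t) + L' (w t)) volume 0 T :=
    ((L.continuous.comp_continuousOn hz).intervalIntegrable_of_Icc hT |>.const_mul c).add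
      (intervalIntegrable_clm_comp hw L')
  refine ⟨hx.cont.add (hy.cont.const_smul ε), fun k t ht => ?_, fun k t ht => ?_⟩
  · have hsum := add_integral_linearCombination (c₁ := (x 0).fst k) (c₂ := (y 0).fst k) (ε := ε) ht
      (hint (sndCoord k) (fstCoord k) (ω k) hx.cont hf)
      (hint (sndCoord k) (fstCoord k) (ω k) hy.cont hg)
    simp only [fstCoord_apply, sndCoord_apply, ← hx.fst_eq k t ht, ← hy.fst_eq k t ht] at hsum
    simp only [← fstCoord_apply, ← sndCoord_apply, map_add, map_smul, smul_eq_mul] at hsum ⊢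
    rw [hsum]
    congr 2 with s
    ring
  · have hsum := add_integral_linearCombination (c₁ := (x 0).snd k) (c₂ := (y 0).snd k) (ε := ε) ht
      (hint (fstCoord k) (sndCoord k) (-ω k) hx.cont hf)
      (hint (fstCoord k) (sndCoord k) (-ω k) hy.cont hg)
    simp only [fstCoord_apply, sndCoord_apply, neg_mul, ← hx.snd_eq k t ht,
      ← hy.snd_eq k t ht] at hsum
    simp only [← fstCoord_apply, ← sndCoord_apply, map_add, map_smul, smul_eq_mul] at hsum ⊢
    rw [hsum]
    congr 2 with s
    ring

theorem sub (hy : IsSolution ω T g y) (hT : 0 ≤ T) (hf : IntervalIntegrable f volume 0 T)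
    (hg : IntervalIntegrable g volume 0 T) :
    IsSolution ω T (fun t => f t - g t) fun t => x t - y t := by
  simpa [sub_eq_add_neg] using hx.add_smul hy hT hf hg (-1)

theorem hasDerivAt_fst (hf : ContinuousOn f (Set.Icc 0 T)) (k : ℕ) {t : ℝ}
    (ht : t ∈ Set.Ioo 0 T) :
    HasDerivAt (fun t => (x t).fst k) (ω k * (x t).snd k + (f t).fst k) t :=
  hasDerivAt_of_eq_add_integral
    ((continuousOn_const.mul ((sndCoord k).continuous.comp_continuousOn hx.cont)).add
      ((fstCoord k).continuous.comp_continuousOn hf)) (hx.fst_eq k) ht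

theorem hasDerivAt_snd (hf : ContinuousOn f (Set.Icc 0 T)) (k : ℕ) {t : ℝ}
    (ht : t ∈ Set.Ioo 0 T) :
    HasDerivAt (fun t => (x t).snd k) (-(ω k * (x t).fst k) + (f t).snd k) t :=
  hasDerivAt_of_eq_add_integral
    ((continuousOn_const.mul ((fstCoord k).continuous.comp_continuousOn hx.cont)).neg.add
      ((sndCoord k).continuous.comp_continuousOn hf)) (hx.snd_eq k) ht

end IsSolution

end Solutions

section Modes

/-- The coordinates `(η_k ∓ i ξ_k) / √2` of `(ξ, η) ∈ H` in the orthonormal eigenbasis of `A`. -/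
noncomputable def modalCoord (y : H) : ℕ ⊕ ℕ → ℂ :=
  Sum.elim (fun k => ((y.snd k : ℂ) - Complex.I * y.fst k) / (√2 : ℝ))
    (fun k => ((y.snd k : ℂ) + Complex.I * y.fst k) / (√2 : ℝ))

/-- The eigenfrequencies of `A`: the mode `n` has eigenvalue `i * modalFreq ω n`. -/
def modalFreq (ω : ℕ → ℝ) : ℕ ⊕ ℕ → ℝ := Sum.elim (fun k => -ω k) ω

theorem norm_modalCoord_inl_sq (y : H) (k : ℕ) :
    ‖modalCoord y (Sum.inl k)‖ ^ 2 = (y.fst k ^ 2 + y.snd k ^ 2) / 2 := by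
  rw [modalCoord, Sum.elim_inl, norm_div, div_pow, Complex.norm_real, Real.norm_eq_abs, sq_abs,
    Real.sq_sqrt zero_le_two, ← Complex.normSq_eq_norm_sq, Complex.normSq_apply]
  simp
  ring

theorem norm_modalCoord_inr_sq (y : H) (k : ℕ) :
    ‖modalCoord y (Sum.inr k)‖ ^ 2 = (y.fst k ^ 2 + y.snd k ^ 2) / 2 := by
  rw [modalCoord, Sum.elim_inr, norm_div, div_pow, Complex.norm_real, Real.norm_eq_abs, sq_abs,
    Real.sq_sqrt zero_le_two, ← Complex.normSq_eq_norm_sq, Complex.normSq_apply]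
  simp
  ring

theorem hasSum_norm_modalCoord_sq (y : H) : HasSum (fun n => ‖modalCoord y n‖ ^ 2) (‖y‖ ^ 2) := by
  have hH : HasSum (fun k => (y.fst k ^ 2 + y.snd k ^ 2) / 2) (‖y‖ ^ 2 / 2) := by
    rw [WithLp.prod_norm_sq_eq_of_L2]
    exact ((hasSum_ell2_sq _).add (hasSum_ell2_sq _)).div_const 2
  rw [← add_halves (‖y‖ ^ 2)]
  exact HasSum.sum (hH.congr_fun fun k => norm_modalCoord_inl_sq y k)
    (hH.congr_fun fun k => norm_modalCoord_inr_sq y k)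

/-- The expansion of `H` in the eigenbasis of `A`, as an isometry into `ℓ²(ℕ ⊕ ℕ, ℂ)`. -/
noncomputable def modes : H →ₗᵢ[ℝ] ℓ²(ℕ ⊕ ℕ, ℂ) where
  toFun y := ⟨modalCoord y, memℓp_gen (by simpa using (hasSum_norm_modalCoord_sq y).summable)⟩
  map_add' y z := by
    ext n
    change modalCoord (y + z) n = modalCoord y n + modalCoord z n
    rcases n with k | k <;> simp [modalCoord] <;> ring
  map_smul' c y := by
    ext (k | k) <;> simp [modalCoord] <;> ring
  norm_map' y := by
    refine (sq_eq_sq₀ (norm_nonneg _) (norm_nonneg _)).1 ?_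
    exact (hasSum_norm_sq _).unique (hasSum_norm_modalCoord_sq y)

theorem modes_apply_inl (y : H) (k : ℕ) :
    modes y (Sum.inl k) = ((y.snd k : ℂ) - Complex.I * y.fst k) / (√2 : ℝ) := rfl

theorem modes_apply_inr (y : H) (k : ℕ) :
    modes y (Sum.inr k) = ((y.snd k : ℂ) + Complex.I * y.fst k) / (√2 : ℝ) := rfl

theorem modes_vecB_inl (b : Ell2 ℝ) (k : ℕ) : modes (vecB b) (Sum.inl k) = b k / (√2 : ℝ) := by
  simp [modes_apply_inl, vecB]

theorem modes_vecB_inr (b : Ell2 ℝ) (k : ℕ) : modes (vecB b) (Sum.inr k) = b k / (√2 : ℝ) := by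
  simp [modes_apply_inr, vecB]

theorem re_inner_modes (x y : H) : (⟪modes x, modes y⟫_ℂ).re = ⟪x, y⟫_ℝ := by
  have hcomplex := re_inner_eq_norm_add_mul_self_sub_norm_mul_self_sub_norm_mul_self_div_two
    (𝕜 := ℂ) (modes x) (modes y)
  rw [← map_add, modes.norm_map, modes.norm_map, modes.norm_map] at hcomplex
  rw [real_inner_eq_norm_add_mul_self_sub_norm_mul_self_sub_norm_mul_self_div_two]
  exact hcomplex

theorem inner_modes_vecB (b : Ell2 ℝ) (y : H) :
    ⟪modes (vecB b), modes y⟫_ℂ = ((⟪vecB b, y⟫_ℝ : ℝ) : ℂ) := by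
  have hsum := (lp.hasSum_inner (𝕜 := ℂ) (modes (vecB b)) (modes y)).summable
  have hl := hsum.comp_injective Sum.inl_injective
  have hr := hsum.comp_injective Sum.inr_injective
  have hpair (k : ℕ) : ⟪modes (vecB b) (Sum.inl k), modes y (Sum.inl k)⟫_ℂ +
      ⟪modes (vecB b) (Sum.inr k), modes y (Sum.inr k)⟫_ℂ = ((b k * y.snd k : ℝ) : ℂ) := by
    have hsqrt : ((√2 : ℝ) : ℂ) ^ 2 = 2 := by
      rw [← Complex.ofReal_pow, Real.sq_sqrt zero_le_two, Complex.ofReal_ofNat]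
    rw [modes_vecB_inl, modes_vecB_inr, modes_apply_inl, modes_apply_inr]
    simp only [RCLike.inner_apply, map_div₀, Complex.conj_ofReal, Complex.ofReal_mul]
    field_simp
    rw [hsqrt]
    ring
  rw [lp.inner_eq_tsum, hl.tsum_sum hr, inner_vecB, Complex.ofReal_tsum]
  exact (hl.tsum_add hr).symm.trans (tsum_congr hpair)

variable {ω : ℕ → ℝ} {T : ℝ} {f g x y : ℝ → H}

theorem IsSolution.isForcedOscillation_modes (hy : IsSolution ω T f y)
    (hf : ContinuousOn f (Set.Icc 0 T)) :
    IsForcedOscillation (modalFreq ω) 0 T (fun t => modes (f t)) fun t => modes (y t) where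
  forcing_cont := modes.continuous.comp_continuousOn hf
  cont := modes.continuous.comp_continuousOn hy.cont
  hasDerivAt n t ht := by
    rcases n with k | k <;>
    · have hfst := (hy.hasDerivAt_fst hf k ht).ofReal_comp
      have hsnd := (hy.hasDerivAt_snd hf k ht).ofReal_comp
      simp only [modes_apply_inl, modes_apply_inr, modalFreq, Sum.elim_inl, Sum.elim_inr]
      first
      | convert! (hsnd.sub (hfst.const_mul Complex.I)).div_const ((√2 : ℝ) : ℂ) using 1
        push_cast
        linear_combination (y t).fst k * ω k / (√2 : ℝ) * Complex.I_mul_I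
      | convert! (hsnd.add (hfst.const_mul Complex.I)).div_const ((√2 : ℝ) : ℂ) using 1
        push_cast
        linear_combination (y t).fst k * ω k / (√2 : ℝ) * Complex.I_mul_I

theorem IsSolution.hasDerivAt_inner (hx : IsSolution ω T f x) (hy : IsSolution ω T g y)
    (hf : ContinuousOn f (Set.Icc 0 T)) (hg : ContinuousOn g (Set.Icc 0 T)) {t : ℝ}
    (ht : t ∈ Set.Ioo 0 T) :
    HasDerivAt (fun t => ⟪x t, y t⟫_ℝ) (⟪f t, y t⟫_ℝ + ⟪x t, g t⟫_ℝ) t := by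
  have hmodal := (hx.isForcedOscillation_modes hf).hasDerivAt_inner
    (hy.isForcedOscillation_modes hg) ht
  have hre := Complex.reCLM.hasFDerivAt.comp_hasDerivAt t hmodal
  simpa only [Function.comp_def, Complex.reCLM_apply, Complex.add_re, re_inner_modes] using hre

end Modes

section Response

variable {h : ℝ → ℝ}

/-- The solution `z` of the complex oscillator `z' = iνz + h`, `z(0) = 0`, by Duhamel's formula. -/
noncomputable def duhamel (ν : ℝ) (h : ℝ → ℝ) (t : ℝ) : ℂ :=
  Complex.exp (ν * t * Complex.I) *
    ∫ s in (0 : ℝ)..t, Complex.exp ((-ν : ℝ) * s * Complex.I) * h s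

theorem hasDerivAt_duhamel (ν : ℝ) (hh : Continuous h) (t : ℝ) :
    HasDerivAt (duhamel ν h) (Complex.I * ν * duhamel ν h t + h t) t := by
  have hintegrand : Continuous fun s : ℝ => Complex.exp ((-ν : ℝ) * s * Complex.I) * h s := by
    fun_prop
  convert! (hasDerivAt_exp_mul_I ν t).mul (intervalIntegral.integral_hasDerivAt_right
    (hintegrand.intervalIntegrable 0 t)
    (hintegrand.stronglyMeasurableAtFilter _ _) hintegrand.continuousAt) using 1
  have hinverse : Complex.exp (ν * t * Complex.I) * Complex.exp ((-ν : ℝ) * t * Complex.I) = 1 := by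
    rw [← Complex.exp_add, Complex.ofReal_neg, neg_mul, neg_mul, add_neg_cancel, Complex.exp_zero]
  rw [duhamel]
  linear_combination -(h t : ℂ) * hinverse

theorem norm_duhamel_le (ν : ℝ) (h : ℝ → ℝ) (t : ℝ) :
    ‖duhamel ν h t‖ ≤ |∫ s in (0 : ℝ)..t, ‖h s‖| := by
  rw [duhamel, norm_mul, norm_exp_mul_I, one_mul]
  refine intervalIntegral.norm_integral_le_abs_integral_norm.trans (le_of_eq ?_)
  simp only [norm_mul, norm_exp_mul_I, one_mul, Complex.norm_real]

theorem continuous_of_abs_apply_le_mul {b : Ell2 ℝ} {y : ℝ → Ell2 ℝ} {m : ℝ → ℝ}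
    (hy : ∀ k, Continuous fun t => y t k) (hm : Continuous m)
    (hbound : ∀ k t, |y t k| ≤ |b k| * m t) : Continuous y := by
  refine continuous_iff_continuousAt.2 fun t₀ => tendsto_iff_norm_sub_tendsto_zero.2 ?_
  suffices hsq : Tendsto (fun t => ‖y t - y t₀‖ ^ 2) (𝓝 t₀) (𝓝 0) by simpa using hsq.sqrt
  have htsum : (fun t => ‖y t - y t₀‖ ^ 2) = fun t => ∑' k, (y t k - y t₀ k) ^ 2 :=
    funext fun t => (hasSum_ell2_sq (y t - y t₀)).tsum_eq.symm
  rw [htsum, ← tsum_zero (α := ℝ) (β := ℕ)]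
  refine tendsto_tsum_of_dominated_convergence (bound := fun k => b k ^ 2 * (2 * m t₀ + 1) ^ 2)
    ((hasSum_ell2_sq b).summable.mul_right _) (fun k => ?_) ?_
  · simpa using (((hy k).tendsto t₀).sub_const (y t₀ k)).pow 2
  · filter_upwards [(hm.tendsto t₀).eventually_lt_const (lt_add_one _)] with t ht k
    rw [norm_pow, ← sq_abs (b k), ← mul_pow]
    gcongr
    calc |y t k - y t₀ k| ≤ |b k| * m t + |b k| * m t₀ :=
          (abs_sub _ _).trans (add_le_add (hbound k t) (hbound k t₀))
      _ ≤ |b k| * (2 * m t₀ + 1) := by nlinarith [abs_nonneg (b k)]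

theorem exists_continuous_apply_eq_mul (b : Ell2 ℝ) {φ : ℕ → ℝ → ℝ} {m : ℝ → ℝ}
    (hφ : ∀ k, Continuous (φ k)) (hm : Continuous m) (hbound : ∀ k t, |φ k t| ≤ m t) :
    ∃ y : ℝ → Ell2 ℝ, Continuous y ∧ ∀ t k, y t k = b k * φ k t := by
  have hmul (k : ℕ) (t : ℝ) : |b k * φ k t| ≤ |b k| * m t := by
    rw [abs_mul]
    gcongr
    exact hbound k t
  have hmem (t : ℝ) : Memℓp (fun k => b k * φ k t) 2 :=
    ((lp.memℓp b).const_mul (m t)).mono' fun k => (hmul k t).trans <| by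
      rw [norm_mul, mul_comm, Real.norm_eq_abs, Real.norm_eq_abs]
      gcongr
      exact le_abs_self _
  exact ⟨fun t => ⟨fun k => b k * φ k t, hmem t⟩,
    continuous_of_abs_apply_le_mul (fun k => continuous_const.mul (hφ k)) hm hmul, fun _ _ => rfl⟩

theorem exists_response (ω : ℕ → ℝ) (b : Ell2 ℝ) (hh : Continuous h) (T : ℝ) :
    ∃ y, IsSolution ω T (fun t => h t • vecB b) y ∧ y 0 = 0 := by
  have hcont (k : ℕ) : Continuous (duhamel (ω k) h) :=
    continuous_iff_continuousAt.2 fun t => (hasDerivAt_duhamel (ω k) hh t).continuousAt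
  have hm : Continuous fun t => |∫ s in (0 : ℝ)..t, ‖h s‖| :=
    (intervalIntegral.continuous_primitive (fun _ _ => hh.norm.intervalIntegrable _ _) 0).abs
  obtain ⟨ξ, hξ, hξ_apply⟩ := exists_continuous_apply_eq_mul b
    (fun k => Complex.continuous_im.comp (hcont k)) hm
    fun k t => (Complex.abs_im_le_norm _).trans (norm_duhamel_le (ω k) h t)
  obtain ⟨η, hη, hη_apply⟩ := exists_continuous_apply_eq_mul b
    (fun k => Complex.continuous_re.comp (hcont k)) hm
    fun k t => (Complex.abs_re_le_norm _).trans (norm_duhamel_le (ω k) h t)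
  simp only [Function.comp_apply] at hξ_apply hη_apply
  refine ⟨fun t => WithLp.toLp 2 (ξ t, η t), .of_hasDerivAt (by fun_prop) (by fun_prop)
    (fun k t _ => ?_) (fun k t _ => ?_), ?_⟩
  · simp only [WithLp.toLp_fst, WithLp.toLp_snd, hξ_apply, hη_apply, fst_smul_vecB]
    convert! (Complex.imCLM.hasFDerivAt.comp_hasDerivAt t
      (hasDerivAt_duhamel (ω k) hh t)).const_mul (b k) using 1
    simp; ring
  · simp only [WithLp.toLp_fst, WithLp.toLp_snd, hξ_apply, hη_apply, snd_smul_vecB]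
    convert! (Complex.reCLM.hasFDerivAt.comp_hasDerivAt t
      (hasDerivAt_duhamel (ω k) hh t)).const_mul (b k) using 1
    simp; ring
  · have hξ_zero : ξ 0 = 0 := by ext k; simp [hξ_apply, duhamel]
    have hη_zero : η 0 = 0 := by ext k; simp [hη_apply, duhamel]
    simp [hξ_zero, hη_zero]

end Response

section Optimality

variable {ω : ℕ → ℝ} {b : Ell2 ℝ} {T ubar : ℝ} {x0 xbar : H} {x y Λ : ℝ → H} {u h : ℝ → ℝ}

theorem IsAdmissible.intervalIntegrable (hx : IsAdmissible ω b T x0 x u) (hT : 0 ≤ T) :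
    IntervalIntegrable u volume 0 T := by
  rw [intervalIntegrable_iff_integrableOn_Ioc_of_le hT]
  exact hx.memLp.integrable (by norm_num)

theorem IsAdmissible.add_smul (hx : IsAdmissible ω b T x0 x u) (hT : 0 ≤ T) (hh : Continuous h)
    (hy : IsSolution ω T (fun t => h t • vecB b) y) (hy0 : y 0 = 0) (ε : ℝ) :
    IsAdmissible ω b T x0 (fun t => x t + ε • y t) fun t => u t + ε * h t where
  memLp := by
    obtain ⟨M, hM⟩ := isCompact_Icc.exists_bound_of_continuousOn
      (hh.continuousOn (s := Set.Icc 0 T))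
    have hh_memLp : MemLp h 2 (volume.restrict (Set.Ioc 0 T)) :=
      .of_bound hh.aestronglyMeasurable M <| (ae_restrict_mem measurableSet_Ioc).mono
        fun t ht => hM t (Set.Ioc_subset_Icc_self ht)
    exact hx.memLp.add (hh_memLp.const_mul ε)
  sol := by
    have hu := hx.intervalIntegrable hT
    have hsol := hx.sol.add_smul hy hT (hu.smul_continuousOn continuousOn_const)
      ((hh.smul continuous_const).intervalIntegrable 0 T) ε
    simpa only [_root_.add_smul, mul_smul] using hsol
  init := by simp [hx.init, hy0]

theorem cost_add_smul (x xbar y : H) (u ubar h ε : ℝ) :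
    ‖x + ε • y - xbar‖ ^ 2 + |u + ε * h - ubar| ^ 2 =
      (‖x - xbar‖ ^ 2 + |u - ubar| ^ 2) + 2 * ε * (inner ℝ (x - xbar) y + (u - ubar) * h) +
        ε ^ 2 * (‖y‖ ^ 2 + h ^ 2) := by
  rw [add_sub_right_comm, norm_add_sq_real, norm_smul, inner_smul_right, sq_abs, sq_abs, mul_pow,
    Real.norm_eq_abs, sq_abs]
  ring

theorem eq_zero_of_forall_add_mul_add_sq_mul_ge {c c₁ c₂ : ℝ}
    (h : ∀ ε : ℝ, c ≤ c + 2 * ε * c₁ + ε ^ 2 * c₂) : c₁ = 0 := by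
  have hdiscrim := discrim_le_zero (a := c₂) (b := 2 * c₁) (c := 0) fun ε => by linarith [h ε]
  rw [discrim] at hdiscrim
  nlinarith [sq_nonneg c₁]

namespace IsDynamicSolution

variable (hs : IsDynamicSolution ω b T x0 xbar ubar x Λ u)

include hs

theorem continuousOn_state_sub : ContinuousOn (fun t => x t - xbar) (Set.Icc 0 T) :=
  hs.admissible.sol.cont.sub continuousOn_const

theorem continuousOn_inner_adjoint :
    ContinuousOn (fun t => inner ℝ (vecB b) (Λ t)) (Set.Icc 0 T) :=
  continuousOn_const.inner (𝕜 := ℝ) hs.adjoint.cont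

theorem integral_variation_eq_zero (hT : 0 ≤ T) (hh : Continuous h)
    (hy : IsSolution ω T (fun t => h t • vecB b) y) (hy0 : y 0 = 0) :
    ∫ t in (0 : ℝ)..T, (inner ℝ (x t - xbar) (y t) + (u t - ubar) * h t) = 0 := by
  have hcost : IntervalIntegrable (fun t => ‖x t - xbar‖ ^ 2 + |u t - ubar| ^ 2) volume 0 T := by
    refine ((hs.continuousOn_state_sub.norm.pow 2).intervalIntegrable_of_Icc hT).add ?_
    rw [intervalIntegrable_iff_integrableOn_Ioc_of_le hT]
    simp only [sq_abs]
    exact (hs.admissible.memLp.sub (memLp_const ubar)).integrable_sq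
  have hfirst : IntervalIntegrable
      (fun t => inner ℝ (x t - xbar) (y t) + (u t - ubar) * h t) volume 0 T :=
    ((hs.continuousOn_state_sub.inner (𝕜 := ℝ) hy.cont).intervalIntegrable_of_Icc hT).add
      (((hs.admissible.intervalIntegrable hT).sub intervalIntegrable_const).mul_continuousOn
        hh.continuousOn)
  have hsecond : IntervalIntegrable (fun t => ‖y t‖ ^ 2 + h t ^ 2) volume 0 T :=
    ((hy.cont.norm.pow 2).add (hh.pow 2).continuousOn).intervalIntegrable_of_Icc hT
  refine eq_zero_of_forall_add_mul_add_sq_mul_ge (c := dynCost T xbar ubar x u)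
    (c₂ := ∫ t in (0 : ℝ)..T, (‖y t‖ ^ 2 + h t ^ 2)) fun ε => ?_
  calc dynCost T xbar ubar x u
      ≤ dynCost T xbar ubar (fun t => x t + ε • y t) (fun t => u t + ε * h t) :=
        hs.minimal _ _ (hs.admissible.add_smul hT hh hy hy0 ε)
    _ = _ := by
        simp only [dynCost, cost_add_smul]
        rw [intervalIntegral.integral_add (hcost.add (hfirst.const_mul _)) (hsecond.const_mul _),
          intervalIntegral.integral_add hcost (hfirst.const_mul _),
          intervalIntegral.integral_const_mul, intervalIntegral.integral_const_mul]

theorem integral_adjoint_eq_zero (hT : 0 ≤ T) (hh : Continuous h)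
    (hy : IsSolution ω T (fun t => h t • vecB b) y) (hy0 : y 0 = 0) :
    ∫ t in (0 : ℝ)..T, (inner ℝ (x t - xbar) (y t) + inner ℝ (vecB b) (Λ t) * h t) = 0 := by
  have hforcing : ContinuousOn (fun t => h t • vecB b) (Set.Icc 0 T) :=
    (hh.smul continuous_const).continuousOn
  have hderiv : IntervalIntegrable
      (fun t => inner ℝ (x t - xbar) (y t) + inner ℝ (vecB b) (Λ t) * h t) volume 0 T :=
    ((hs.continuousOn_state_sub.inner (𝕜 := ℝ) hy.cont).add
      (hs.continuousOn_inner_adjoint.mul hh.continuousOn)).intervalIntegrable_of_Icc hT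
  rw [intervalIntegral.integral_eq_sub_of_hasDerivAt_of_le hT
    (hs.adjoint.cont.inner (𝕜 := ℝ) hy.cont) (fun t ht => ?_) hderiv]
  · simp [hs.terminal, hy0]
  · convert! hs.adjoint.hasDerivAt_inner hy hs.continuousOn_state_sub hforcing ht using 2
    rw [real_inner_smul_right, real_inner_comm, mul_comm]

theorem integral_smul_control_defect_eq_zero (hT : 0 ≤ T) (hh : Continuous h) :
    ∫ t in (0 : ℝ)..T, h t • (u t - ubar - inner ℝ (vecB b) (Λ t)) = 0 := by
  obtain ⟨y, hy, hy0⟩ := exists_response ω b hh T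
  have hstate := (hs.continuousOn_state_sub.inner (𝕜 := ℝ) hy.cont).intervalIntegrable_of_Icc
    (μ := volume) hT
  have hu : IntervalIntegrable (fun t => (u t - ubar) * h t) volume 0 T :=
    ((hs.admissible.intervalIntegrable hT).sub intervalIntegrable_const).mul_continuousOn
      hh.continuousOn
  have hcontrol : IntervalIntegrable (fun t => inner ℝ (vecB b) (Λ t) * h t) volume 0 T :=
    (hs.continuousOn_inner_adjoint.mul hh.continuousOn).intervalIntegrable_of_Icc hT
  calc ∫ t in (0 : ℝ)..T, h t • (u t - ubar - inner ℝ (vecB b) (Λ t))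
      = ∫ t in (0 : ℝ)..T, ((inner ℝ (x t - xbar) (y t) + (u t - ubar) * h t) -
          (inner ℝ (x t - xbar) (y t) + inner ℝ (vecB b) (Λ t) * h t)) := by
        simp only [smul_eq_mul, add_sub_add_left_eq_sub, mul_sub, mul_comm]
    _ = 0 - 0 := by
        rw [intervalIntegral.integral_sub (hstate.add hu) (hstate.add hcontrol),
          hs.integral_variation_eq_zero hT hh hy hy0, hs.integral_adjoint_eq_zero hT hh hy hy0]
    _ = 0 := sub_zero 0

theorem control_eq (hT : 0 ≤ T) :
    ∀ᵐ t, t ∈ Set.Ioo 0 T → u t - ubar - inner ℝ (vecB b) (Λ t) = 0 := by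
  have hdefect : IntervalIntegrable (fun t => u t - ubar - inner ℝ (vecB b) (Λ t)) volume 0 T :=
    ((hs.admissible.intervalIntegrable hT).sub intervalIntegrable_const).sub
      (hs.continuousOn_inner_adjoint.intervalIntegrable_of_Icc hT)
  rw [intervalIntegrable_iff_integrableOn_Ioc_of_le hT] at hdefect
  refine isOpen_Ioo.ae_eq_zero_of_integral_contDiff_smul_eq_zero
    (hdefect.mono_set Set.Ioo_subset_Ioc_self).locallyIntegrableOn fun h hh _ hsupport => ?_
  rw [← hs.integral_smul_control_defect_eq_zero hT hh.continuous,
    intervalIntegral.integral_of_le hT]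
  refine (setIntegral_eq_integral_of_forall_compl_eq_zero fun t ht => ?_).symm
  have ht_notMem : t ∉ tsupport h := fun hmem => ht (Set.Ioo_subset_Ioc_self (hsupport hmem))
  rw [image_eq_zero_of_notMem_tsupport ht_notMem, zero_smul]

theorem isSolution_feedback (hT : 0 ≤ T) :
    IsSolution ω T (fun t => (ubar + inner ℝ (vecB b) (Λ t)) • vecB b) x :=
  hs.admissible.sol.congr_ae <| (hs.control_eq hT).mono fun t ht hmem => by
    rw [show u t = ubar + inner ℝ (vecB b) (Λ t) by linarith [ht hmem]]

end IsDynamicSolution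

end Optimality

section Discrepancy

variable {ω : ℕ → ℝ} {b : Ell2 ℝ} {T ubar uhat : ℝ} {x0 xbar xhat Lhat : H} {x Λ : ℝ → H}
  {u : ℝ → ℝ}

namespace IsStaticSolution

variable (hst : IsStaticSolution ω b xbar ubar xhat Lhat uhat)

include hst

theorem isSolution_state (T : ℝ) : IsSolution ω T (fun _ => uhat • vecB b) fun _ => xhat :=
  .const (fun k => by rw [fst_smul_vecB, add_zero]; exact (hst.feasible k).1)
    (fun k => by rw [snd_smul_vecB]; exact (hst.feasible k).2) T

theorem isSolution_multiplier (T : ℝ) : IsSolution ω T (fun _ => xhat - xbar) fun _ => Lhat :=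
  .const
    (fun k => by
      rw [← fstCoord_apply k (xhat - xbar), map_sub, fstCoord_apply, fstCoord_apply, hst.stat_fst,
        add_neg_cancel])
    (fun k => by
      rw [← sndCoord_apply k (xhat - xbar), map_sub, sndCoord_apply, sndCoord_apply, hst.stat_snd,
        neg_add_cancel]) T

end IsStaticSolution

namespace IsDynamicSolution

variable (hs : IsDynamicSolution ω b T x0 xbar ubar x Λ u)
  (hst : IsStaticSolution ω b xbar ubar xhat Lhat uhat)

include hs hst

theorem isSolution_state_sub (hT : 0 ≤ T) :
    IsSolution ω T (fun t => inner ℝ (vecB b) (Λ t - Lhat) • vecB b) fun t => x t - xhat := by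
  have hfeedback : ContinuousOn (fun t => (ubar + inner ℝ (vecB b) (Λ t)) • vecB b)
      (Set.Icc 0 T) :=
    (continuousOn_const.add hs.continuousOn_inner_adjoint).smul continuousOn_const
  convert! (hs.isSolution_feedback hT).sub (hst.isSolution_state T) hT
    (hfeedback.intervalIntegrable_of_Icc hT) intervalIntegrable_const using 2
  rw [← sub_smul, inner_sub_right, ← hst.stat_control]
  congr 1
  ring

theorem isSolution_adjoint_sub (hT : 0 ≤ T) :
    IsSolution ω T (fun t => x t - xhat) fun t => Λ t - Lhat := by
  convert! hs.adjoint.sub (hst.isSolution_multiplier T) hT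
    (hs.continuousOn_state_sub.intervalIntegrable_of_Icc hT) intervalIntegrable_const using 2
  exact (sub_sub_sub_cancel_right _ _ _).symm

theorem modalSystem_sub (hT : 0 ≤ T) :
    ModalSystem (modalFreq ω) (modes (vecB b)) 0 T (fun t => modes (x t - xhat))
      fun t => modes (Λ t - Lhat) where
  p_forced := by
    have hcont : ContinuousOn (fun t => inner ℝ (vecB b) (Λ t - Lhat) • vecB b) (Set.Icc 0 T) :=
      (continuousOn_const.inner (𝕜 := ℝ) (hs.adjoint.cont.sub continuousOn_const)).smul
        continuousOn_const
    convert! (hs.isSolution_state_sub hst hT).isForcedOscillation_modes hcont using 2 with t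
    rw [inner_modes_vecB, map_smul, Complex.coe_smul]
    rfl
  q_forced := (hs.isSolution_adjoint_sub hst hT).isForcedOscillation_modes
    (hs.admissible.sol.cont.sub continuousOn_const)

end IsDynamicSolution

end Discrepancy

section Frequencies

variable {ω : ℕ → ℝ}

theorem CondA2.strictMono (h : CondA2 ω) : StrictMono ω := by
  obtain ⟨_, ωs, hpos, hgap⟩ := h
  exact strictMono_nat_of_lt_succ fun k => by linarith [hgap k]

theorem CondA2.pos (h : CondA2 ω) (k : ℕ) : 0 < ω k :=
  h.1.trans_le (h.strictMono.monotone (Nat.zero_le k))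

theorem CondA2.injective_modalFreq (h : CondA2 ω) : Function.Injective (modalFreq ω) :=
  (neg_injective.comp h.strictMono.injective).sumElim h.strictMono.injective
    fun j k => ((neg_neg_of_pos (h.pos j)).trans (h.pos k)).ne

theorem CondA3.exists_sum_le (h : CondA3 ω) :
    ∃ C, 0 ≤ C ∧ ∀ k (s : Finset ℕ), ∑ j ∈ s, 1 / (ω k - ω j) ^ 2 ≤ C := by
  obtain ⟨C, hC⟩ := h
  refine ⟨C, (tsum_nonneg fun j => by positivity).trans (hC 0).2, fun k s => ?_⟩
  calc ∑ j ∈ s, 1 / (ω k - ω j) ^ 2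
      = ∑ j ∈ s.subtype (· ≠ k), 1 / (ω k - ω j) ^ 2 := by
        rw [Finset.sum_subtype_eq_sum_filter (p := (· ≠ k)) (fun j => 1 / (ω k - ω j) ^ 2)]
        refine (Finset.sum_filter_of_ne fun j _ hj => ?_).symm
        rintro rfl
        simp at hj
    _ ≤ ∑' j : {j : ℕ // j ≠ k}, 1 / (ω k - ω j) ^ 2 :=
        (hC k).1.sum_le_tsum _ fun j _ => by positivity
    _ ≤ C := (hC k).2

theorem one_div_add_sq_le {x y : ℝ} (hx : 0 < x) (hxy : x < y) :
    1 / (x + y) ^ 2 ≤ 1 / (x - y) ^ 2 := by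
  rw [← neg_sub y, neg_sq]
  have : 0 < y - x := sub_pos.2 hxy
  gcongr
  linarith

theorem exists_sum_add_le (h2 : CondA2 ω) (h3 : CondA3 ω) :
    ∃ C, 0 ≤ C ∧ ∀ k (s : Finset ℕ), ∑ j ∈ s, 1 / (ω k + ω j) ^ 2 ≤ C := by
  obtain ⟨C, hC0, hC⟩ := h3.exists_sum_le
  have hω0 := h2.pos 0
  refine ⟨1 / ω 0 ^ 2 + C, by positivity, fun k s => ?_⟩
  have hterm (j : ℕ) :
      1 / (ω k + ω j) ^ 2 ≤ (if j = 0 then 1 / ω 0 ^ 2 else 0) + 1 / (ω 0 - ω j) ^ 2 := by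
    have hk := h2.strictMono.monotone (Nat.zero_le k)
    rcases Nat.eq_zero_or_pos j with rfl | hj
    · rw [if_pos rfl, sub_self, zero_pow two_ne_zero, div_zero, add_zero]
      gcongr
      linarith
    · rw [if_neg hj.ne', zero_add]
      refine le_trans ?_ (one_div_add_sq_le hω0 (h2.strictMono hj))
      have := h2.pos j
      gcongr
  calc ∑ j ∈ s, 1 / (ω k + ω j) ^ 2
      ≤ ∑ j ∈ s, ((if j = 0 then 1 / ω 0 ^ 2 else 0) + 1 / (ω 0 - ω j) ^ 2) :=
        Finset.sum_le_sum fun j _ => hterm j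
    _ ≤ 1 / ω 0 ^ 2 + C := by
        rw [Finset.sum_add_distrib, Finset.sum_ite_eq']
        refine add_le_add ?_ (hC 0 s)
        split_ifs
        · exact le_rfl
        · positivity

theorem exists_squareSeparated_modalFreq (h2 : CondA2 ω) (h3 : CondA3 ω) :
    ∃ K, SquareSeparated (modalFreq ω) K := by
  obtain ⟨C, hC0, hC⟩ := h3.exists_sum_le
  obtain ⟨D, hD0, hD⟩ := exists_sum_add_le h2 h3
  refine ⟨C + D, h2.injective_modalFreq, add_nonneg hC0 hD0, fun n s => ?_⟩
  rw [Finset.sum_sum_eq_sum_toLeft_add_sum_toRight]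
  rcases n with k | k
  · simpa only [modalFreq, Sum.elim_inl, Sum.elim_inr, sub_neg_eq_add, neg_add_eq_sub,
      add_comm (ω k)] using add_le_add (hC k s.toLeft) (hD k s.toRight)
  · rw [add_comm C]
    simpa only [modalFreq, Sum.elim_inl, Sum.elim_inr, neg_sub_left, neg_sq,
      sub_sq_comm (ω k)] using add_le_add (hD k s.toLeft) (hC k s.toRight)

end Frequencies

section WeightedNorm

variable {ω : ℕ → ℝ} {b : Ell2 ℝ}

theorem vTerm_zero_one (y : H) (k : ℕ) :
    vTerm ω b 0 1 y k = (y.fst k ^ 2 + y.snd k ^ 2) / b k ^ 2 := by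
  rw [vTerm, mul_zero, Real.rpow_zero, one_mul, mul_one, Real.rpow_two, sq_abs]

theorem vTerm_zero_one_nonneg (y : H) (k : ℕ) : 0 ≤ vTerm ω b 0 1 y k := by
  rw [vTerm_zero_one]
  positivity

theorem MemV.hasSum {y : H} (hy : MemV ω b 0 1 y) :
    HasSum (vTerm ω b 0 1 y) (normV ω b 0 1 y ^ 2) := by
  rw [normV, Real.sq_sqrt (tsum_nonneg (vTerm_zero_one_nonneg y))]
  exact Summable.hasSum hy

theorem MemV.sub {x y : H} (hx : MemV ω b 0 1 x) (hy : MemV ω b 0 1 y) :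
    MemV ω b 0 1 (x - y) := by
  refine Summable.of_nonneg_of_le (vTerm_zero_one_nonneg _) (fun k => ?_)
    ((Summable.mul_left 2 hx).add (Summable.mul_left 2 hy))
  rw [vTerm_zero_one, vTerm_zero_one, vTerm_zero_one, ← fstCoord_apply k (x - y),
    ← sndCoord_apply k (x - y), map_sub, map_sub, fstCoord_apply, fstCoord_apply, sndCoord_apply,
    sndCoord_apply, ← mul_div_assoc, ← mul_div_assoc, ← add_div]
  refine div_le_div_of_nonneg_right ?_ (sq_nonneg _)
  nlinarith [sq_nonneg (x.fst k + y.fst k), sq_nonneg (x.snd k + y.snd k)]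

theorem summable_one_div_sq (h2 : CondA2 ω) (h3 : CondA3 ω) :
    Summable fun k => 1 / ω k ^ 2 := by
  obtain ⟨C, -, hC⟩ := exists_sum_add_le h2 h3
  have hshift : Summable fun k => 1 / (ω 0 + ω k) ^ 2 :=
    summable_of_sum_le (fun k => by positivity) (hC 0)
  refine Summable.of_nonneg_of_le (fun k => by positivity) (fun k => ?_) (hshift.mul_left 4)
  have h0 := h2.pos 0
  have hk := h2.pos k
  have hle := h2.strictMono.monotone (Nat.zero_le k)
  rw [mul_one_div, div_le_div_iff₀ (by positivity) (by positivity)]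
  nlinarith

theorem StaticConstraint.memV {x : H} {u : ℝ} (h : StaticConstraint ω b x u) (h1 : CondA1 b)
    (h2 : CondA2 ω) (h3 : CondA3 ω) : MemV ω b 0 1 x := by
  refine ((summable_one_div_sq h2 h3).mul_left (u ^ 2)).congr fun k => ?_
  have hω := (h2.pos k).ne'
  have hb := h1 k
  have hsnd : x.snd k = 0 := (mul_eq_zero.1 (h k).1).resolve_left hω
  have hfst : x.fst k = b k * u / ω k := by
    rw [eq_div_iff hω]
    linarith [(h k).2]
  rw [vTerm_zero_one, hsnd, hfst]
  field_simp
  ring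

theorem modes_vecB_ne_zero (h1 : CondA1 b) : ∀ n, modes (vecB b) n ≠ 0 := by
  rintro (k | k)
  · simpa [modes_vecB_inl] using h1 k
  · simpa [modes_vecB_inr] using h1 k

theorem MemV.exists_modes_eq_coupling {y : H} (hy : MemV ω b 0 1 y) (h1 : CondA1 b) :
    ∃ r : ℓ²(ℕ ⊕ ℕ, ℂ),
      modes y = coupling (modes (vecB b)) r ∧ ‖r‖ ^ 2 = 2 * normV ω b 0 1 y ^ 2 := by
  have hquot {z : ℂ} {k : ℕ} (hz : ‖z‖ ^ 2 = (y.fst k ^ 2 + y.snd k ^ 2) / 2) :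
      ‖z / (b k / (√2 : ℝ))‖ ^ 2 = vTerm ω b 0 1 y k := by
    have hb := h1 k
    rw [vTerm_zero_one, norm_div, norm_div, div_pow, div_pow, hz, Complex.norm_real,
      Complex.norm_real, Real.norm_eq_abs, Real.norm_eq_abs, sq_abs, sq_abs,
      Real.sq_sqrt zero_le_two]
    field_simp
  have hsum : HasSum (fun n => ‖modes y n / modes (vecB b) n‖ ^ 2) (2 * normV ω b 0 1 y ^ 2) := by
    rw [two_mul]
    refine HasSum.sum (hy.hasSum.congr_fun fun k => ?_) (hy.hasSum.congr_fun fun k => ?_)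
    · rw [Function.comp_apply, modes_vecB_inl]
      exact hquot (norm_modalCoord_inl_sq y k)
    · rw [Function.comp_apply, modes_vecB_inr]
      exact hquot (norm_modalCoord_inr_sq y k)
  refine ⟨⟨_, memℓp_gen (by simpa using hsum.summable)⟩, ?_, (hasSum_norm_sq _).unique hsum⟩
  ext n
  exact (mul_div_cancel₀ (modes y n) (modes_vecB_ne_zero h1 n)).symm

theorem norm_sq_toComplex (a : Ell2 ℝ) : ‖toComplex a‖ ^ 2 = ‖a‖ ^ 2 :=
  (hasSum_norm_sq (toComplex a)).unique <| (hasSum_ell2_sq a).congr_fun fun k => by simp [toComplex]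

theorem norm_sq_discrepancy (x Λ : ℝ → H) (xhat Lhat : H) (t : ℝ) :
    ‖discrepancy x Λ xhat Lhat t‖ ^ 2 = ‖x t - xhat‖ ^ 2 + ‖Λ t - Lhat‖ ^ 2 := by
  rw [PiLp.norm_sq_eq_of_L2, WithLp.prod_norm_sq_eq_of_L2, WithLp.prod_norm_sq_eq_of_L2,
    Fin.sum_univ_four]
  simp only [discrepancy, Matrix.cons_val, norm_sq_toComplex]
  ring

theorem exists_discrepancy_bound (h1 : CondA1 b) (h2 : CondA2 ω) (h3 : CondA3 ω) :
    ∃ M, 0 < M ∧ ∀ {T ubar uhat : ℝ} {x0 xbar xhat Lhat : H} {x Λ : ℝ → H} {u : ℝ → ℝ}, 0 ≤ T →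
      MemV ω b 0 1 x0 → IsStaticSolution ω b xbar ubar xhat Lhat uhat →
      IsDynamicSolution ω b T x0 xbar ubar x Λ u →
      ‖discrepancy x Λ xhat Lhat 0‖ ^ 2 + ‖discrepancy x Λ xhat Lhat T‖ ^ 2 ≤
        M * (2 * normV ω b 0 1 (x 0 - xhat) ^ 2 + ‖Lhat‖ ^ 2) := by
  obtain ⟨K, hK⟩ := exists_squareSeparated_modalFreq h2 h3
  obtain ⟨C, hC0, hC⟩ := hK.exists_boundary_bound (modes (vecB b)) (modes_vecB_ne_zero h1)
  refine ⟨‖vecB b‖ ^ 2 + C + 1, by positivity, ?_⟩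
  intro T ubar uhat x0 xbar xhat Lhat x Λ u hT hx0 hst hs
  have hmem : MemV ω b 0 1 (x 0 - xhat) := by
    rw [hs.admissible.init]
    exact hx0.sub (hst.feasible.memV h1 h2 h3)
  obtain ⟨r, hr, hr_norm⟩ := hmem.exists_modes_eq_coupling h1
  have hinitial : ‖x 0 - xhat‖ ^ 2 ≤ ‖vecB b‖ ^ 2 * ‖r‖ ^ 2 := by
    rw [← modes.norm_map, hr, ← modes.norm_map (vecB b)]
    exact norm_coupling_sq_le _ r
  have hboundary := hC hT (hs.modalSystem_sub hst hT) hr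
  have hterminal : ‖Λ T - Lhat‖ = ‖Lhat‖ := by rw [hs.terminal, zero_sub, norm_neg]
  simp only [modes.norm_map, hterminal] at hboundary
  rw [norm_sq_discrepancy, norm_sq_discrepancy, hterminal, ← hr_norm]
  nlinarith [mul_nonneg (sq_nonneg ‖vecB b‖) (sq_nonneg ‖Lhat‖), sq_nonneg ‖r‖]

end WeightedNorm

end OscTurnpike

theorem mainTheorem7 (ω : ℕ → ℝ) (b : OscTurnpike.Ell2 ℝ)
    (hA1 : OscTurnpike.CondA1 b) (hA2 : OscTurnpike.CondA2 ω) (hA3 : OscTurnpike.CondA3 ω) :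
    ∃ C : ℝ, 0 < C ∧
      ∀ (T : ℝ), 0 < T →
      ∀ (x0 xbar : OscTurnpike.H) (ubar : ℝ), OscTurnpike.MemV ω b 0 1 x0 →
      ∀ (xhat Lhat : OscTurnpike.H) (uhat : ℝ),
        OscTurnpike.IsStaticSolution ω b xbar ubar xhat Lhat uhat →
      ∀ (x Λ : ℝ → OscTurnpike.H) (u : ℝ → ℝ),
        OscTurnpike.IsDynamicSolution ω b T x0 xbar ubar x Λ u →
        ‖OscTurnpike.discrepancy x Λ xhat Lhat 0‖ + ‖OscTurnpike.discrepancy x Λ xhat Lhat T‖ ≤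
          C * (OscTurnpike.normV ω b 0 1 (x 0 - xhat) + ‖Lhat.fst‖ + ‖Lhat.snd‖) := by
  obtain ⟨M, hM, hbound⟩ := OscTurnpike.exists_discrepancy_bound hA1 hA2 hA3
  refine ⟨2 * √M, by positivity, ?_⟩
  intro T hT x0 xbar ubar hx0 xhat Lhat uhat hstatic x Λ u hdynamic
  have hsq := hbound hT.le hx0 hstatic hdynamic
  rw [WithLp.prod_norm_sq_eq_of_L2] at hsq
  set V := OscTurnpike.normV ω b 0 1 (x 0 - xhat)
  have hV : 0 ≤ V := Real.sqrt_nonneg _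
  have hl := norm_nonneg Lhat.fst
  have hm := norm_nonneg Lhat.snd
  refine le_of_sq_le_sq ?_ (by positivity)
  calc (‖OscTurnpike.discrepancy x Λ xhat Lhat 0‖ + ‖OscTurnpike.discrepancy x Λ xhat Lhat T‖) ^ 2
      ≤ 2 * (M * (2 * V ^ 2 + (‖Lhat.fst‖ ^ 2 + ‖Lhat.snd‖ ^ 2))) :=
        add_sq_le.trans (by gcongr)
    _ ≤ 2 * (M * (2 * (V + ‖Lhat.fst‖ + ‖Lhat.snd‖) ^ 2)) := by
        gcongr
        nlinarith [mul_nonneg hV hl, mul_nonneg hV hm, mul_nonneg hl hm]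
    _ = (2 * √M * (V + ‖Lhat.fst‖ + ‖Lhat.snd‖)) ^ 2 := by
        rw [mul_pow, mul_pow, Real.sq_sqrt hM.le]
        ring
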